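/- Let $M=\langle\mathcal S,\mathcal A,P,R,\gamma,\rho\rangle$ be a Markov decision process with discount $\gamma\in[0,1)$, initial state distribution $\rho$, a measurable state space $\mathcal S$ with a $\sigma$-finite reference measure, and a discrete (countable) action space $\mathcal A$; densities on $\mathcal S\times\mathcal A$ are taken with respect to the reference measure times the counting measure. For a stationary policy $\pi:\mathcal S\to\Delta(\mathcal A)$ let $Q^\pi(s,a)$ be its expected discounted sum of rewards from $(s,a)$, $v^\pi$ its expected discounted sum of rewards from $s_0\sim\rho$, and $v^\star=\sup_\pi v^\pi$. For a possibly non-stationary policy $\pi$ let $\eta^\pi_h$ be the law of $(s_h,a_h)$ under $\pi$ with $s_0\sim\rho$; for stationary $\pi$ let $\eta^\pi=(1-\gamma)\sum_{h\ge 0}\gamma^h\eta^\pi_h$, and write $\Pr(\,\cdot\mid\pi)$ for the probability of an event under $(s,a)\sim\eta^\pi$. Assume $0\le Q^\pi(s,a)\le V_{\max}$ for all $\pi,s,a$, and $|r|\le V_{\max}$ almost surely under $R(s,a)$ for all $(s,a)$. Let $\mu$ be a probability density on $\mathcal S\times\mathcal A$, let $D=\{(s_i,a_i,r_i,s_i')\}_{i=1}^n$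 be $n\ge1$ i.i.d. samples with $(s_i,a_i)\sim\mu$, $r_i\sim R(s_i,a_i)$, $s_i'\sim P(s_i,a_i)$, and let $\widehat\mu$ be a (possibly random, jointly measurable) probability density on $\mathcal S\times\mathcal A$ that is independent of $D$. Let $b>0$, $\delta\in(0,1)$, $\epsilon\ge0$, let $\mathcal F$ be a finite set of measurable functions $\mathcal S\times\mathcal A\to[0,V_{\max}]$, and put $$\zeta(s,a)=\mathbf 1(\widehat\mu(s,a)\ge b),\qquad (\widetilde{\mathcal T}f)(s,a)=\mathbb E[r\mid s,a]+\gamma\,\mathbb E_{s'\sim P(s,a)}\big[\max_{a'}\zeta(s',a')f(s',a')\big],$$ $$\mathcal L_D(f;f')=\frac1n\sum_{i=1}^n\big(f(s_i,a_i)-r_i-\gamma\max_{a'}\zeta(s'_i,a')f'(s'_i,a')\big)^2 .$$ MBS-QI starts from some $f_0\in\mathcal F$, takes $f_{k+1}\in\arg\min_{f\in\mathcal F}\mathcal L_D(f;f_k)$, and after $t\ge1$ iterations outputs a (measurable) deterministic policy $\widehat\pi_t(s)\in\arg\max_a\zeta(s,a)f_t(s,a)$. Assume: 1. (bounded densities)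 for every non-stationary policy $\pi$ and every $h\ge0$, $\eta^\pi_h$ has a density that is at most $U$; 2. (density estimation error) with probability at least $1-\delta$, $\|\widehat\mu-\mu\|_{\mathrm{TV}}\le\epsilon_\mu$, where $\|\cdot\|_{\mathrm{TV}}$ is the largest difference of the probabilities of an event; 3. (completeness) almost surely, $\max_{f\in\mathcal F}\min_{g\in\mathcal F}\|g-\widetilde{\mathcal T}f\|_{2,\mu}^2\le\epsilon'_{\mathcal F}$, where $\|g\|_{2,\mu}=(\mathbb E_{(s,a)\sim\mu}\,g(s,a)^2)^{1/2}$; 4. $\pi^\star$ is an optimal policy, that is, $v^{\pi^\star}=v^\star$, and $\Pr(\mu(s,a)\le 2b\mid\pi^\star)\le\epsilon$. Then, with $C=U/b$ and an absolute constant $c>0$, with probability at least $1-2\delta$ every output $\widehat\pi_t$ of MBS-QI (for every initial $f_0\in\mathcal F$ and every way of breaking ties) satisfies $v^{\widehat\pi_t}\ge v^\star-\Delta$, where $$\Delta=\frac{2C\left(c\sqrt{\dfrac{V_{\max}^2\ln(|\mathcal F|/\delta)}{n}}+\sqrt{\epsilon'_{\mathcal F}}+V_{\max}\epsilon_\mu+\big\|Q^{\pi^\star}-\widetilde{\mathcal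 T}Q^{\pi^\star}\big\|_{2,\mu}\right)}{(1-\gamma)^2}+\frac{(2\gamma^t+\epsilon+C\epsilon_\mu)\,V_{\max}}{1-\gamma}.$$ -/

import Mathlib

open MeasureTheory ProbabilityTheory

namespace MBSQI

noncomputable section

/-- A Markov decision process: dynamics `P`, (random) rewards `R`, discount factor `γ`,
initial state distribution `ρ`. -/
structure MDP (S A : Type*) [MeasurableSpace S] [MeasurableSpace A] where
  /-- law of the next state given the current state-action pair -/
  P : Kernel (S × A) S
  /-- law of the reward given the current state-action pair -/
  R : Kernel (S × A) ℝ
  /-- discount factor -/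
  γ : ℝ
  /-- law of the initial state -/
  ρ : Measure S
  markov_P : IsMarkovKernel P
  markov_R : IsMarkovKernel R
  prob_ρ : IsProbabilityMeasure ρ
  γ_nonneg : 0 ≤ γ
  γ_lt_one : γ < 1

attribute [instance] MDP.markov_P MDP.markov_R MDP.prob_ρ

/-- A stationary (randomized) policy: a conditional distribution over actions given the state. -/
structure Policy (S A : Type*) [MeasurableSpace S] [MeasurableSpace A] where
  /-- law of the action given the state -/
  kernel : Kernel S A
  markov : IsMarkovKernel kernel

attribute [instance] Policy.markov

/-- The deterministic policy that plays `g s` in state `s`. -/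
def Policy.ofFun {S A : Type*} [MeasurableSpace S] [MeasurableSpace A]
    (g : S → A) (hg : Measurable g) : Policy S A where
  kernel := Kernel.deterministic g hg
  markov := inferInstance

/-- `p` is a probability density with respect to the reference measure `ν`. -/
structure IsProbDensity {X : Type*} [MeasurableSpace X] (ν : Measure X) (p : X → ℝ) : Prop where
  measurable : Measurable p
  nonneg : ∀ x, 0 ≤ p x
  lintegral_eq_one : ∫⁻ x, ENNReal.ofReal (p x) ∂ν = 1

/-- The measure with density `p` with respect to `ν`. -/
def densityMeasure {X : Type*} [MeasurableSpace X] (ν : Measure X) (p : X → ℝ) : Measure X :=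
  ν.withDensity fun x => ENNReal.ofReal (p x)

/-- `m` has a density with respect to `ν` that is bounded by `U`. -/
def HasDensityLE {X : Type*} [MeasurableSpace X] (ν : Measure X) (U : ℝ) (m : Measure X) : Prop :=
  ∃ p : X → ℝ, Measurable p ∧ (∀ x, 0 ≤ p x ∧ p x ≤ U) ∧ m = densityMeasure ν p

/-- Total variation distance of two probability measures: the largest difference of the
probabilities that they assign to an event. -/
def tvDist {X : Type*} [MeasurableSpace X] (m₁ m₂ : Measure X) : ℝ :=
  ⨆ B : {B : Set X // MeasurableSet B}, |m₁.real B.1 - m₂.real B.1|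

/-- The property `E` holds with probability at least `p` (on a measurable event of that
probability). -/
def HoldsWithProbGE {Ω : Type*} [MeasurableSpace Ω] (m : Measure Ω) (p : ℝ) (E : Ω → Prop) :
    Prop :=
  ∃ G : Set Ω, MeasurableSet G ∧ ENNReal.ofReal p ≤ m G ∧ ∀ ω ∈ G, E ω

/-- The norm `‖g‖_{2,m}`. -/
def l2norm {X : Type*} [MeasurableSpace X] (m : Measure X) (g : X → ℝ) : ℝ :=
  Real.sqrt (∫ x, g x ^ 2 ∂m)

section MDPNotions

variable {S A : Type*} [MeasurableSpace S] [MeasurableSpace A]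

/-- The law of `(s_{h+1}, a_{h+1})` given `(s_h, a_h)` when `a_{h+1}` is drawn from `π`. -/
def MDP.step (M : MDP S A) (π : Policy S A) : Kernel (S × A) (S × A) :=
  (Kernel.id ×ₖ π.kernel) ∘ₖ M.P

/-- The law of `(s_h, a_h)` given `(s_0, a_0)`, when the action at time `h ≥ 1` is drawn from
`π h`; the policy may be non-stationary. -/
def MDP.pairKernel (M : MDP S A) (π : ℕ → Policy S A) : ℕ → Kernel (S × A) (S × A)
  | 0 => Kernel.id
  | h + 1 => M.step (π (h + 1)) ∘ₖ M.pairKernel π h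

/-- `η_h^π`: the law of `(s_h, a_h)` under the (non-stationary) policy `π`, with `s_0 ∼ ρ`. -/
def MDP.eta (M : MDP S A) (π : ℕ → Policy S A) (h : ℕ) : Measure (S × A) :=
  M.pairKernel π h ∘ₘ (M.ρ ⊗ₘ (π 0).kernel)

/-- The discounted state-action distribution `η^π = (1 - γ) ∑_h γ^h η_h^π`. The probability
of an event under `π` refers to this distribution. -/
def MDP.etaDisc (M : MDP S A) (π : Policy S A) : Measure (S × A) :=
  Measure.sum fun h : ℕ => ENNReal.ofReal ((1 - M.γ) * M.γ ^ h) • M.eta (fun _ => π) h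

/-- The mean reward `r(s,a)`. -/
def MDP.meanReward (M : MDP S A) (x : S × A) : ℝ := ∫ r, r ∂(M.R x)

/-- `Q^π(s,a)`: expected discounted sum of rewards from `(s,a)` on, following `π` afterwards. -/
def MDP.Q (M : MDP S A) (π : Policy S A) (x : S × A) : ℝ :=
  ∑' h : ℕ, M.γ ^ h * ∫ y, M.meanReward y ∂(M.pairKernel (fun _ => π) h x)

/-- `V^π(s)`. -/
def MDP.V (M : MDP S A) (π : Policy S A) (s : S) : ℝ := ∫ a, M.Q π (s, a) ∂(π.kernel s)

/-- `v^π`: the expectation of `V^π` under the initial state distribution. -/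
def MDP.value (M : MDP S A) (π : Policy S A) : ℝ := ∫ s, M.V π s ∂M.ρ

/-- The optimal value `v^⋆`. -/
def MDP.optValue (M : MDP S A) : ℝ := ⨆ π : Policy S A, M.value π

/-- `π` is an optimal policy: no policy has a larger value. -/
def MDP.IsOptimal (M : MDP S A) (π : Policy S A) : Prop :=
  ∀ π' : Policy S A, M.value π' ≤ M.value π

/-- The filtered function `ζ ∘ f (s,a) = 𝟙(μ̂(s,a) ≥ b) f(s,a)`. -/
def filtered (muhat : S × A → ℝ) (b : ℝ) (f : S × A → ℝ) (x : S × A) : ℝ :=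
  {y | b ≤ muhat y}.indicator f x

/-- `max_a ζ ∘ f (s,a)`. -/
def maxFiltered (muhat : S × A → ℝ) (b : ℝ) (f : S × A → ℝ) (s : S) : ℝ :=
  ⨆ a : A, filtered muhat b f (s, a)

/-- The `ζ`-constrained Bellman optimality operator. -/
def MDP.bellman (M : MDP S A) (muhat : S × A → ℝ) (b : ℝ) (f : S × A → ℝ) (x : S × A) : ℝ :=
  M.meanReward x + M.γ * ∫ s', maxFiltered muhat b f s' ∂(M.P x)

/-- A sample `((s, a), (r, s'))`. -/
abbrev Sample (S A : Type*) := (S × A) × (ℝ × S)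

/-- The law of one sample: `(s,a) ∼ m`, and then `r ∼ R(s,a)` and `s' ∼ P(s,a)`,
independently of each other. -/
def MDP.sampleLaw (M : MDP S A) (m : Measure (S × A)) : Measure (Sample S A) :=
  m ⊗ₘ (M.R ×ₖ M.P)

/-- The law of a dataset of `n` i.i.d. samples. -/
def MDP.datasetLaw (M : MDP S A) (m : Measure (S × A)) (n : ℕ) :
    Measure (Fin n → Sample S A) :=
  Measure.pi fun _ => M.sampleLaw m

/-- The empirical loss `L_D(f; f')`. -/
def empLoss {n : ℕ} (γ : ℝ) (muhat : S × A → ℝ) (b : ℝ) (D : Fin n → Sample S A)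
    (f f' : S × A → ℝ) : ℝ :=
  (∑ i, (f (D i).1 - (D i).2.1 - γ * maxFiltered muhat b f' (D i).2.2) ^ 2) / n

/-- `g` (as a deterministic policy) is a possible output of MBS-QI after `t` iterations on the
dataset `D`, for some initial function in `F` and some way of breaking ties in the argmins
and in the argmax. -/
def IsOutput {n : ℕ} (γ : ℝ) (F : Finset (S × A → ℝ)) (muhat : S × A → ℝ) (b : ℝ)
    (D : Fin n → Sample S A) (t : ℕ) (g : S → A) : Prop :=
  ∃ f : ℕ → S × A → ℝ,
    f 0 ∈ F ∧
    (∀ k < t, f (k + 1) ∈ F ∧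
      ∀ u ∈ F, empLoss γ muhat b D (f (k + 1)) (f k) ≤ empLoss γ muhat b D u (f k)) ∧
    ∀ s a, filtered muhat b (f t) (s, a) ≤ filtered muhat b (f t) (s, g s)

end MDPNotions

/-- The error bound, with `C = U / b`; `res` is the Bellman residual, `N = |F|`, and `c` is the
constant hidden in the `O(·)`. -/
def errorBound (c γ Vmax U b δ epsF epsMu epsZeta res : ℝ) (N n t : ℕ) : ℝ :=
  2 * (U / b) *
      (c * Real.sqrt (Vmax ^ 2 * Real.log (N / δ) / n) + Real.sqrt epsF + Vmax * epsMu + res) /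
      (1 - γ) ^ 2 +
    (2 * γ ^ t + epsZeta) * Vmax / (1 - γ)

end

end MBSQI

open MeasureTheory ProbabilityTheory

namespace MBSQI

noncomputable section

/-! ### Integrals of bounded functions and of kernels. -/

section Integration

variable {X Y : Type*} [MeasurableSpace X] [MeasurableSpace Y]

/-! The engine is a pointwise domination. Where `muhat` is at least `b`, a density `p ≤ U` satisfies
`p ≤ (U / b) * muhat ≤ (U / b) * mu + (U / b) * max (muhat - mu) 0`. Hence a one-step error can be
moved from any reachable law to `mu` at the price `U / b`, and the mass not dominated by `mu` costs
the uniform bound `V` times a total variation (`integral_filtered_le`). Reachable laws stay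
reachable after one more step of any policy, so Bellman-type inequalities can be iterated along
them.

Write `q` for the action value of `πstar`. The difference of `q` and the iterate `k + 1` is
controlled by the Bellman residual of `q`, the regression error, and `γ` times an expected filtered
maximum of the previous difference. A near-maximizing action rule turns that maximum into an
integral against another reachable law, which gives the recursion `e (k + 1) = K + γ * e k`
(`integral_filtered_abs_sub_le`). The overestimation of the greedy policy's action value by the last
iterate satisfies a similar inequality with itself on the right, solved by contraction
(`integral_filtered_posPart_sub_Q_le`). In `value_le_value_ofFun_add` the two are combined; passing
from `πstar` to the filtered maximum of `q` loses value only at time `0`, on pairs with `muhat < b`,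
which coverage makes rare.

The regression error must be of order `n ^ (-1/2)` in norm, hence of order `1 / n` when squared.
This fast rate is available because the second moment of the excess loss is bounded by the squared
regression errors (`integral_excessLoss_sq_le`), so an exponential moment bound with a temperature
adapted to these errors is self-bounding (`le_add_of_temperature_bound`). For a fixed density
estimate a union bound over triples from `F` covers all iterates at once; Fubini then adds the
randomness of the estimate. -/

lemma integrable_of_measurable_of_abs_le {m : Measure X} [IsFiniteMeasure m] {f : X → ℝ}
    (hf : Measurable f) {C : ℝ} (h : ∀ x, |f x| ≤ C) : Integrable f m :=
  Integrable.of_bound hf.aestronglyMeasurable C (ae_of_all _ h)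

lemma abs_integral_le_of_ae_abs_le {m : Measure X} [IsProbabilityMeasure m] {f : X → ℝ} {C : ℝ}
    (h : ∀ᵐ x ∂m, |f x| ≤ C) : |∫ x, f x ∂m| ≤ C := by
  simpa using norm_integral_le_of_norm_le_const (μ := m) (f := f) (C := C) h

lemma abs_integral_le_of_abs_le {m : Measure X} [IsProbabilityMeasure m] {f : X → ℝ} {C : ℝ}
    (h : ∀ x, |f x| ≤ C) : |∫ x, f x ∂m| ≤ C :=
  abs_integral_le_of_ae_abs_le (ae_of_all _ h)

lemma integral_measure_comp {κ : Kernel X Y} {m : Measure X} [IsSFiniteKernel κ] [SFinite m]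
    {f : Y → ℝ} (hf : Integrable f (κ ∘ₘ m)) :
    ∫ y, f y ∂(κ ∘ₘ m) = ∫ x, ∫ y, f y ∂κ x ∂m := by
  rw [Measure.comp_eq_comp_const_apply] at hf ⊢
  rw [ProbabilityTheory.Kernel.integral_comp hf]
  simp

lemma measurable_integral_kernel {κ : Kernel X Y} {f : Y → ℝ} (hf : Measurable f) :
    Measurable fun x => ∫ y, f y ∂κ x :=
  (StronglyMeasurable.integral_kernel hf.stronglyMeasurable).measurable

lemma abs_le_of_mem_Icc {V x : ℝ} (h : 0 ≤ x ∧ x ≤ V) : |x| ≤ V := by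
  rw [abs_of_nonneg h.1]; exact h.2

end Integration

/-! ### State-action laws and their closure under policy steps. -/

section Dynamics

variable {S A : Type*} [MeasurableSpace S] [MeasurableSpace A] (M : MDP S A)

instance (π : Policy S A) : IsMarkovKernel (M.step π) := by
  unfold MDP.step; infer_instance

instance isMarkovKernel_pairKernel (π : ℕ → Policy S A) (h : ℕ) :
    IsMarkovKernel (M.pairKernel π h) := by
  induction h with
  | zero => unfold MDP.pairKernel; infer_instance
  | succ h ih => unfold MDP.pairKernel; infer_instance

instance (π : ℕ → Policy S A) (h : ℕ) : IsProbabilityMeasure (M.eta π h) := by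
  unfold MDP.eta; infer_instance

/-- The recursion defining `pairKernel` splits off the last transition, whereas the Bellman equation
needs the first one. For a stationary policy the two agree by associativity. -/
lemma pairKernel_succ_eq_comp_step (π : Policy S A) (h : ℕ) :
    M.pairKernel (fun _ => π) (h + 1) = M.pairKernel (fun _ => π) h ∘ₖ M.step π := by
  induction h with
  | zero => simp [MDP.pairKernel]
  | succ h ih =>
    rw [MDP.pairKernel, ih, ← Kernel.comp_assoc, ← MDP.pairKernel.eq_2 M (fun _ => π) h, ih]

lemma integral_step (π : Policy S A) {f : S × A → ℝ} (hf : Measurable f) {C : ℝ}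
    (hC : ∀ x, |f x| ≤ C) (x : S × A) :
    ∫ y, f y ∂M.step π x = ∫ s, ∫ a, f (s, a) ∂π.kernel s ∂M.P x := by
  unfold MDP.step
  rw [ProbabilityTheory.Kernel.integral_comp (integrable_of_measurable_of_abs_le hf hC)]
  refine integral_congr_ae (ae_of_all _ fun s => ?_)
  simp only
  rw [Kernel.prod_apply, Kernel.id_apply, integral_prod _ (integrable_of_measurable_of_abs_le hf hC),
    integral_dirac']
  exact (hf.stronglyMeasurable.integral_prod_right')

lemma eta_succ (π : ℕ → Policy S A) (h : ℕ) :
    M.eta π (h + 1) = M.step (π (h + 1)) ∘ₘ M.eta π h := by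
  unfold MDP.eta
  rw [Measure.comp_assoc]
  rfl

lemma pairKernel_congr {π π' : ℕ → Policy S A} {h : ℕ} (H : ∀ k ≤ h, π k = π' k) :
    M.pairKernel π h = M.pairKernel π' h := by
  induction h with
  | zero => rfl
  | succ h ih =>
    rw [MDP.pairKernel, MDP.pairKernel, ih fun k hk => H k (by omega), H (h + 1) le_rfl]

lemma eta_congr {π π' : ℕ → Policy S A} {h : ℕ} (H : ∀ k ≤ h, π k = π' k) :
    M.eta π h = M.eta π' h := by
  unfold MDP.eta
  rw [pairKernel_congr M H, H 0 (Nat.zero_le _)]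

lemma eta_zero (π : ℕ → Policy S A) : M.eta π 0 = M.ρ ⊗ₘ (π 0).kernel := by
  simp [MDP.eta, MDP.pairKernel]

/-- The laws of state-action pairs that are reachable under some non-stationary policy. -/
def Reachable (m : Measure (S × A)) : Prop := ∃ π h, m = M.eta π h

variable {M} in
-- Changing the policy at time `h + 1` leaves the law at time `h` intact. This is where bounded
-- densities for non-stationary policies become necessary: the error propagation uses a different
-- policy at each step.
lemma Reachable.step {m : Measure (S × A)} (hm : Reachable M m) (π : Policy S A) :
    Reachable M (M.step π ∘ₘ m) := by
  obtain ⟨π', h, rfl⟩ := hm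
  refine ⟨Function.update π' (h + 1) π, h + 1, ?_⟩
  have hcongr : M.eta (Function.update π' (h + 1) π) h = M.eta π' h :=
    eta_congr M fun k hk => Function.update_of_ne (by omega) _ _
  rw [eta_succ, Function.update_self, hcongr]

lemma reachable_initial (π : Policy S A) : Reachable M (M.ρ ⊗ₘ π.kernel) :=
  ⟨fun _ => π, 0, (eta_zero M fun _ => π).symm⟩

variable {M} in
lemma Reachable.isProbabilityMeasure {m : Measure (S × A)} (hm : Reachable M m) :
    IsProbabilityMeasure m := by
  obtain ⟨π, h, rfl⟩ := hm
  infer_instance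

lemma integral_step_comp (π : Policy S A) (m : Measure (S × A)) [IsProbabilityMeasure m]
    {f : S × A → ℝ} (hf : Measurable f) {C : ℝ} (hC : ∀ x, |f x| ≤ C) :
    ∫ y, f y ∂(M.step π ∘ₘ m) = ∫ x, ∫ s, ∫ a, f (s, a) ∂π.kernel s ∂M.P x ∂m := by
  rw [integral_measure_comp (integrable_of_measurable_of_abs_le hf hC)]
  simp_rw [integral_step M π hf hC]

end Dynamics

/-! ### The Bellman equation for a fixed policy. -/

section BellmanEquation

variable {S A : Type*} [MeasurableSpace S] [MeasurableSpace A] (M : MDP S A)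

lemma measurable_meanReward : Measurable M.meanReward :=
  measurable_integral_kernel (κ := M.R) (f := fun r => r) measurable_id

variable {M}

lemma abs_meanReward_le {V : ℝ} (hR : ∀ x, ∀ᵐ r ∂(M.R x), |r| ≤ V) (x : S × A) :
    |M.meanReward x| ≤ V :=
  abs_integral_le_of_ae_abs_le (hR x)

lemma measurable_Q (π : Policy S A) : Measurable (M.Q π) := by
  unfold MDP.Q
  refine Measurable.tsum fun h => ?_
  exact (measurable_integral_kernel (measurable_meanReward M)).const_mul _

lemma measurable_V (π : Policy S A) : Measurable (M.V π) := by
  have h : StronglyMeasurable (Function.uncurry fun s a => M.Q π (s, a)) :=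
    (measurable_Q π).stronglyMeasurable
  exact (h.integral_kernel_prod_right (κ := π.kernel)).measurable

lemma summable_Q {V : ℝ} (hR : ∀ x, ∀ᵐ r ∂(M.R x), |r| ≤ V) (π : Policy S A) (x : S × A) :
    Summable fun h : ℕ =>
      M.γ ^ h * ∫ y, M.meanReward y ∂(M.pairKernel (fun _ => π) h x) := by
  refine Summable.of_norm_bounded (g := fun h => M.γ ^ h * V)
    ((summable_geometric_of_lt_one M.γ_nonneg M.γ_lt_one).mul_right V) fun h => ?_
  rw [norm_mul, norm_pow, Real.norm_of_nonneg M.γ_nonneg]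
  exact mul_le_mul_of_nonneg_left (abs_integral_le_of_abs_le (abs_meanReward_le hR))
    (pow_nonneg M.γ_nonneg _)

lemma bellman_equation {V : ℝ} (hR : ∀ x, ∀ᵐ r ∂(M.R x), |r| ≤ V) {C : ℝ} (π : Policy S A)
    (hQ : ∀ x, |M.Q π x| ≤ C) (x : S × A) :
    M.Q π x = M.meanReward x + M.γ * ∫ s, M.V π s ∂M.P x := by
  have hr := abs_meanReward_le hR
  have hmeas : ∀ h : ℕ, Measurable fun y =>
      M.γ ^ h * ∫ z, M.meanReward z ∂(M.pairKernel (fun _ => π) h y) := fun h =>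
    (measurable_integral_kernel (measurable_meanReward M)).const_mul _
  have hbd : ∀ (h : ℕ) y,
      |M.γ ^ h * ∫ z, M.meanReward z ∂(M.pairKernel (fun _ => π) h y)| ≤ M.γ ^ h * V := by
    intro h y
    rw [abs_mul, abs_pow, abs_of_nonneg M.γ_nonneg]
    exact mul_le_mul_of_nonneg_left (abs_integral_le_of_abs_le hr) (pow_nonneg M.γ_nonneg _)
  -- The series for `Q` is integrated term by term, dominated by the geometric series `γ ^ h * V`.
  have hint : HasSum
      (fun h : ℕ => ∫ y, M.γ ^ h * ∫ z, M.meanReward z ∂(M.pairKernel (fun _ => π) h y)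
        ∂M.step π x) (∫ y, M.Q π y ∂M.step π x) := by
    refine hasSum_integral_of_summable_integral_norm
      (fun h => integrable_of_measurable_of_abs_le (hmeas h) (hbd h)) ?_
    refine Summable.of_nonneg_of_le (fun h => integral_nonneg fun _ => norm_nonneg _) (fun h => ?_)
      ((summable_geometric_of_lt_one M.γ_nonneg M.γ_lt_one).mul_right V)
    refine (le_abs_self _).trans (abs_integral_le_of_abs_le fun y => ?_)
    rw [abs_of_nonneg (norm_nonneg _)]
    exact hbd h y
  have hV : ∫ s, M.V π s ∂M.P x = ∫ y, M.Q π y ∂M.step π x :=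
    (integral_step M π (measurable_Q π) hQ x).symm
  rw [hV, ← hint.tsum_eq, ← tsum_mul_left]
  conv_lhs => unfold MDP.Q
  rw [(summable_Q hR π x).tsum_eq_zero_add]
  congr 1
  · simp only [MDP.pairKernel, Kernel.id_apply, pow_zero, one_mul]
    exact integral_dirac' _ _ (measurable_meanReward M).stronglyMeasurable
  · refine tsum_congr fun h => ?_
    rw [pairKernel_succ_eq_comp_step, ProbabilityTheory.Kernel.integral_comp
      (integrable_of_measurable_of_abs_le (measurable_meanReward M) hr), integral_const_mul,
      pow_succ']
    ring

end BellmanEquation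

/-! ### Order properties of filtered functions and filtered maxima. -/

section FilteredOrder

variable {S A : Type*} {muhat f g : S × A → ℝ} {b V : ℝ}

lemma filtered_mem_Icc (hV : 0 ≤ V) (hf : ∀ x, 0 ≤ f x ∧ f x ≤ V) (x : S × A) :
    0 ≤ filtered muhat b f x ∧ filtered muhat b f x ≤ V := by
  unfold filtered
  by_cases h : x ∈ {y | b ≤ muhat y}
  · rw [Set.indicator_of_mem h]; exact hf x
  · rw [Set.indicator_of_notMem h]; exact ⟨le_rfl, hV⟩

lemma bddAbove_filtered (hV : 0 ≤ V) (hf : ∀ x, 0 ≤ f x ∧ f x ≤ V) (s : S) :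
    BddAbove (Set.range fun a => filtered muhat b f (s, a)) := by
  refine ⟨V, ?_⟩
  rintro _ ⟨a, rfl⟩
  exact (filtered_mem_Icc hV hf _).2

lemma maxFiltered_mem_Icc (hV : 0 ≤ V) (hf : ∀ x, 0 ≤ f x ∧ f x ≤ V) (s : S) :
    0 ≤ maxFiltered muhat b f s ∧ maxFiltered muhat b f s ≤ V :=
  ⟨Real.iSup_nonneg fun _ => (filtered_mem_Icc hV hf _).1,
    Real.iSup_le (fun _ => (filtered_mem_Icc hV hf _).2) hV⟩

lemma filtered_le_maxFiltered (hV : 0 ≤ V) (hf : ∀ x, 0 ≤ f x ∧ f x ≤ V) (s : S) (a : A) :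
    filtered muhat b f (s, a) ≤ maxFiltered muhat b f s :=
  le_ciSup (bddAbove_filtered hV hf s) a

/-- A difference of filtered maxima is at most the largest filtered difference. -/
lemma abs_maxFiltered_sub_le [Nonempty A] (hV : 0 ≤ V) (hf : ∀ x, 0 ≤ f x ∧ f x ≤ V)
    (hg : ∀ x, 0 ≤ g x ∧ g x ≤ V) (s : S) :
    |maxFiltered muhat b f s - maxFiltered muhat b g s| ≤
      maxFiltered muhat b (fun x => |f x - g x|) s := by
  have hd : ∀ x, 0 ≤ |f x - g x| ∧ |f x - g x| ≤ V := fun x =>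
    ⟨abs_nonneg _, abs_le.2 ⟨by linarith [(hf x).1, (hg x).2], by linarith [(hf x).2, (hg x).1]⟩⟩
  have key : ∀ {u v : S × A → ℝ}, (∀ x, 0 ≤ v x ∧ v x ≤ V) → (∀ x, |u x - v x| = |f x - g x|) →
      maxFiltered muhat b u s ≤ maxFiltered muhat b v s +
        maxFiltered muhat b (fun x => |f x - g x|) s := by
    intro u v hv huv
    refine ciSup_le fun a => ?_
    have h1 := filtered_le_maxFiltered (muhat := muhat) (b := b) hV hv s a
    have h2 := filtered_le_maxFiltered (muhat := muhat) (b := b) hV hd s a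
    refine le_trans ?_ (add_le_add h1 h2)
    unfold filtered
    by_cases h : (s, a) ∈ {y | b ≤ muhat y}
    · simp only [Set.indicator_of_mem h]
      rw [← huv]
      linarith [le_abs_self (u (s, a) - v (s, a))]
    · simp only [Set.indicator_of_notMem h]
      norm_num
  have h1 := key (u := f) hg fun _ => rfl
  have h2 := key (u := g) hf fun _ => abs_sub_comm _ _
  exact abs_le.2 ⟨by linarith, by linarith⟩

end FilteredOrder

/-! ### Measurability, the constrained Bellman operator, and near-maximizers. -/

section Filtered

variable {S A : Type*} [MeasurableSpace S] [MeasurableSpace A] {M : MDP S A}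
  {muhat f : S × A → ℝ} {b V : ℝ}

lemma measurable_filtered (hm : Measurable muhat) (hf : Measurable f) :
    Measurable (filtered muhat b f) :=
  hf.indicator (measurableSet_le measurable_const hm)

lemma measurable_maxFiltered [Countable A] (hm : Measurable muhat) (hf : Measurable f) :
    Measurable (maxFiltered muhat b f) := by
  unfold maxFiltered
  exact Measurable.iSup fun a => (measurable_filtered hm hf).comp measurable_prodMk_right

lemma measurable_bellman [Countable A] (hm : Measurable muhat) (hf : Measurable f) :
    Measurable (M.bellman muhat b f) :=
  (measurable_meanReward M).add
    ((measurable_integral_kernel (measurable_maxFiltered hm hf)).const_mul _)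

lemma abs_bellman_le (hR : ∀ x, ∀ᵐ r ∂(M.R x), |r| ≤ V) (hV : 0 ≤ V)
    (hf : ∀ x, 0 ≤ f x ∧ f x ≤ V) (x : S × A) : |M.bellman muhat b f x| ≤ 2 * V := by
  unfold MDP.bellman
  have h1 := abs_meanReward_le hR x
  have h2 : |∫ s', maxFiltered muhat b f s' ∂(M.P x)| ≤ V :=
    abs_integral_le_of_abs_le fun s => abs_le_of_mem_Icc (maxFiltered_mem_Icc hV hf s)
  have h3 : |M.γ * ∫ s', maxFiltered muhat b f s' ∂(M.P x)| ≤ V := by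
    rw [abs_mul, abs_of_nonneg M.γ_nonneg]
    exact (mul_le_mul M.γ_lt_one.le h2 (abs_nonneg _) zero_le_one).trans (by linarith)
  linarith [abs_add_le (M.meanReward x) (M.γ * ∫ s', maxFiltered muhat b f s' ∂(M.P x))]

/-- Measurable near-maximizers exist when there are countably many actions. -/
lemma exists_measurable_near_maximizer [Countable A] [Nonempty A] (hm : Measurable muhat)
    (hf : Measurable f) {α : ℝ} (hα : 0 < α) :
    ∃ g : S → A, Measurable g ∧
      ∀ s, maxFiltered muhat b f s ≤ filtered muhat b f (s, g s) + α := by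
  classical
  obtain ⟨e, he⟩ := exists_surjective_nat A
  have hex : ∀ s, ∃ k, maxFiltered muhat b f s ≤ filtered muhat b f (s, e k) + α := by
    intro s
    obtain ⟨a, ha⟩ := exists_lt_of_lt_ciSup
      (show maxFiltered muhat b f s - α < ⨆ a, filtered muhat b f (s, a) from sub_lt_self _ hα)
    obtain ⟨k, rfl⟩ := he a
    exact ⟨k, by linarith⟩
  -- Taking the first suitable index in an enumeration of the actions makes the selection
  -- measurable. The slack `α` is needed since a supremum over infinitely many actions may not be
  -- attained.
  refine ⟨fun s => e (Nat.find (hex s)), ?_, fun s => Nat.find_spec (hex s)⟩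
  refine (measurable_from_top (f := e)).comp (measurable_find hex fun k => ?_)
  exact measurableSet_le (measurable_maxFiltered hm hf)
    (((measurable_filtered hm hf).comp measurable_prodMk_right).add_const _)

end Filtered

/-! ### Probability densities, total variation and the `L²` norm. -/

section Density

variable {X : Type*} [MeasurableSpace X] {ν : Measure X} {p q : X → ℝ}

lemma IsProbDensity.isProbabilityMeasure (hp : IsProbDensity ν p) :
    IsProbabilityMeasure (densityMeasure ν p) :=
  ⟨by rw [densityMeasure, withDensity_apply _ MeasurableSet.univ, Measure.restrict_univ,
    hp.lintegral_eq_one]⟩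

lemma IsProbDensity.integrable (hp : IsProbDensity ν p) : Integrable p ν := by
  refine ⟨hp.measurable.aestronglyMeasurable, ?_⟩
  rw [hasFiniteIntegral_iff_ofReal (ae_of_all _ hp.nonneg), hp.lintegral_eq_one]
  exact ENNReal.one_lt_top

lemma IsProbDensity.integrable_mul (hp : IsProbDensity ν p) {w : X → ℝ} (hw : Measurable w)
    {C : ℝ} (hC : ∀ x, |w x| ≤ C) : Integrable (fun x => p x * w x) ν :=
  hp.integrable.mul_bdd hw.aestronglyMeasurable (ae_of_all _ hC)

lemma IsProbDensity.integral_densityMeasure (hp : IsProbDensity ν p) (w : X → ℝ) :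
    ∫ x, w x ∂densityMeasure ν p = ∫ x, p x * w x ∂ν := by
  unfold densityMeasure
  rw [integral_withDensity_eq_integral_toReal_smul hp.measurable.ennreal_ofReal
    (ae_of_all _ fun _ => ENNReal.ofReal_lt_top)]
  refine integral_congr_ae (ae_of_all _ fun x => ?_)
  simp [ENNReal.toReal_ofReal (hp.nonneg x)]

lemma IsProbDensity.measureReal (hp : IsProbDensity ν p) {B : Set X} (hB : MeasurableSet B) :
    (densityMeasure ν p).real B = ∫ x in B, p x ∂ν := by
  rw [measureReal_def, densityMeasure, withDensity_apply _ hB,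
    integral_eq_lintegral_of_nonneg_ae (ae_of_all _ hp.nonneg)
      hp.measurable.aestronglyMeasurable]

lemma tvDist_comm (m₁ m₂ : Measure X) : tvDist m₁ m₂ = tvDist m₂ m₁ := by
  unfold tvDist
  simp_rw [abs_sub_comm]

lemma abs_measureReal_sub_le_tvDist (m₁ m₂ : Measure X) [IsProbabilityMeasure m₁]
    [IsProbabilityMeasure m₂] {B : Set X} (hB : MeasurableSet B) :
    |m₁.real B - m₂.real B| ≤ tvDist m₁ m₂ := by
  refine le_ciSup (f := fun B : {B : Set X // MeasurableSet B} => |m₁.real B.1 - m₂.real B.1|)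
    ⟨1, ?_⟩ ⟨B, hB⟩
  rintro _ ⟨B, rfl⟩
  have h1 : 0 ≤ m₁.real B.1 := measureReal_nonneg
  have h2 : 0 ≤ m₂.real B.1 := measureReal_nonneg
  have h3 : m₁.real B.1 ≤ 1 := measureReal_le_one
  have h4 : m₂.real B.1 ≤ 1 := measureReal_le_one
  exact abs_le.2 ⟨by linarith, by linarith⟩

lemma tvDist_nonneg (m₁ m₂ : Measure X) : 0 ≤ tvDist m₁ m₂ :=
  Real.iSup_nonneg fun _ => abs_nonneg _

lemma integrable_posPart_sub (hp : IsProbDensity ν p) (hq : IsProbDensity ν q) :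
    Integrable (fun x => max (p x - q x) 0) ν :=
  (hp.integrable.sub hq.integrable).pos_part

/-- The integral of the positive part is the difference of the two probabilities of the event `q ≤
p`, so no factor `2` is lost. -/
lemma integral_posPart_sub_le_tvDist (hp : IsProbDensity ν p) (hq : IsProbDensity ν q) :
    ∫ x, max (p x - q x) 0 ∂ν ≤ tvDist (densityMeasure ν p) (densityMeasure ν q) := by
  have := hp.isProbabilityMeasure
  have := hq.isProbabilityMeasure
  have hB : MeasurableSet {x | q x ≤ p x} := measurableSet_le hq.measurable hp.measurable
  refine le_trans (le_of_eq ?_) ((le_abs_self _).trans (abs_measureReal_sub_le_tvDist _ _ hB))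
  rw [hp.measureReal hB, hq.measureReal hB,
    ← integral_sub hp.integrable.integrableOn hq.integrable.integrableOn,
    ← integral_indicator hB]
  refine integral_congr_ae (ae_of_all _ fun x => ?_)
  simp only
  by_cases h : q x ≤ p x
  · rw [Set.indicator_of_mem (by exact h), max_eq_left (by linarith)]
  · rw [Set.indicator_of_notMem (by exact h), max_eq_right (by linarith)]

lemma HasDensityLE.exists_isProbDensity {U : ℝ} {m : Measure X} [IsProbabilityMeasure m]
    (h : HasDensityLE ν U m) :
    ∃ p, IsProbDensity ν p ∧ (∀ x, p x ≤ U) ∧ m = densityMeasure ν p := by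
  obtain ⟨p, hp, hb, rfl⟩ := h
  refine ⟨p, ⟨hp, fun x => (hb x).1, ?_⟩, fun x => (hb x).2, rfl⟩
  have := measure_univ (μ := densityMeasure ν p)
  rwa [densityMeasure, withDensity_apply _ MeasurableSet.univ, Measure.restrict_univ] at this

lemma HasDensityLE.nonneg {U : ℝ} {m : Measure X} [IsProbabilityMeasure m]
    (h : HasDensityLE ν U m) : 0 ≤ U := by
  obtain ⟨p, -, hb, -⟩ := h
  obtain ⟨x⟩ := nonempty_of_isProbabilityMeasure m
  exact (hb x).1.trans (hb x).2

lemma integral_abs_le_l2norm {m : Measure X} [IsProbabilityMeasure m] {u : X → ℝ}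
    (hu : Measurable u) {C : ℝ} (hC : ∀ x, |u x| ≤ C) : ∫ x, |u x| ∂m ≤ l2norm m u := by
  refine Real.le_sqrt_of_sq_le ?_
  set c := ∫ x, |u x| ∂m with hc
  have h1 : Integrable (fun x => |u x|) m :=
    integrable_of_measurable_of_abs_le hu.abs (C := C) fun x => by rw [abs_abs]; exact hC x
  have h2 : Integrable (fun x => u x ^ 2) m :=
    integrable_of_measurable_of_abs_le (hu.pow_const 2) (C := C ^ 2) fun x => by
      rw [abs_pow]; exact pow_le_pow_left₀ (abs_nonneg _) (hC x) 2
  -- Nonnegativity of the variance of `|u|`, expanded.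
  have h3 : 0 ≤ ∫ x, (u x ^ 2 - 2 * c * |u x| + c ^ 2) ∂m := integral_nonneg fun x => by
    have : u x ^ 2 - 2 * c * |u x| + c ^ 2 = (|u x| - c) ^ 2 := by rw [sub_sq, sq_abs]; ring
    simp only [this]
    exact sq_nonneg _
  have h4 : Integrable (fun x => u x ^ 2 - 2 * c * |u x|) m := h2.sub (h1.const_mul _)
  rw [integral_add h4 (integrable_const _),
    integral_sub h2 (h1.const_mul _), integral_const_mul, ← hc] at h3
  simp only [integral_const, probReal_univ, one_smul] at h3
  nlinarith

end Density

/-! ### Transfer from reachable laws to the data distribution. -/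

section ChangeOfMeasure

variable {S A : Type*} [MeasurableSpace S] [MeasurableSpace A] {ν : Measure (S × A)}
  {mu muhat : S × A → ℝ} {b U V : ℝ}

/-- Change of measure on the set where `muhat` is at least `b`. The part of the density that is
not dominated by `mu` is charged the uniform bound `V` instead of the pointwise bound `r + z`. -/
lemma integral_filtered_le {m : Measure (S × A)} [IsProbabilityMeasure m]
    (hm : HasDensityLE ν U m) (hmu : IsProbDensity ν mu) (hmuhat : IsProbDensity ν muhat)
    (hb : 0 < b) (hV : 0 ≤ V) {w r z : S × A → ℝ} (hw : Measurable w) (hr : Measurable r)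
    (hz : Measurable z) {R Z : ℝ} (hwV : ∀ x, 0 ≤ w x ∧ w x ≤ V) (hrR : ∀ x, 0 ≤ r x ∧ r x ≤ R)
    (hzZ : ∀ x, 0 ≤ z x ∧ z x ≤ Z) (h : ∀ x, w x ≤ r x + z x) :
    ∫ x, filtered muhat b w x ∂m ≤ U / b * ∫ x, r x ∂densityMeasure ν mu +
      U / b * (V * tvDist (densityMeasure ν muhat) (densityMeasure ν mu)) + ∫ x, z x ∂m := by
  have hU := hm.nonneg
  obtain ⟨p, hp, hpU, rfl⟩ := hm.exists_isProbDensity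
  have hC : 0 ≤ U / b := by positivity
  rw [hp.integral_densityMeasure, hp.integral_densityMeasure, hmu.integral_densityMeasure]
  have I1 := hp.integrable_mul (measurable_filtered (b := b) hmuhat.measurable hw)
    (fun x => abs_le_of_mem_Icc (filtered_mem_Icc hV hwV x))
  have I2 := hmu.integrable_mul hr (fun x => abs_le_of_mem_Icc (hrR x))
  have I3 := integrable_posPart_sub hmuhat hmu
  have I4 := hp.integrable_mul hz (fun x => abs_le_of_mem_Icc (hzZ x))
  have key : ∫ x, p x * filtered muhat b w x ∂ν ≤
      ∫ x, (U / b * (mu x * r x) + U / b * V * max (muhat x - mu x) 0 + p x * z x) ∂ν := by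
    refine integral_mono I1 (((I2.const_mul _).add (I3.const_mul _)).add I4) fun x => ?_
    have hp0 := hp.nonneg x
    have hmu0 := hmu.nonneg x
    have hr0 := (hrR x).1
    have hz0 := (hzZ x).1
    have hmax0 : 0 ≤ max (muhat x - mu x) 0 := le_max_right _ _
    simp only
    unfold filtered
    by_cases hx : x ∈ {y | b ≤ muhat y}
    · rw [Set.indicator_of_mem hx]
      have hUm : U ≤ U / b * muhat x := by
        rw [div_mul_eq_mul_div, le_div_iff₀ hb]
        exact mul_le_mul_of_nonneg_left hx hU
      -- Either `p` is dominated by `(U / b) * mu` and `w ≤ r + z` suffices, or `p` is split into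
      -- `(U / b) * mu` and an excess. The excess is at most `(U / b) * (muhat - mu)` because `p ≤ U
      -- ≤ (U / b) * muhat` here, and on it `w` is bounded by `V`.
      rcases le_total (p x) (U / b * mu x) with hle | hle
      · have h1 : p x * w x ≤ p x * r x + p x * z x := by
          rw [← mul_add]; exact mul_le_mul_of_nonneg_left (h x) hp0
        have h2 : p x * r x ≤ U / b * (mu x * r x) := by
          rw [← mul_assoc]; exact mul_le_mul_of_nonneg_right hle hr0
        have h3 : 0 ≤ U / b * V * max (muhat x - mu x) 0 := by positivity
        linarith
      · have h1 : U / b * mu x * w x ≤ U / b * mu x * (r x + z x) :=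
          mul_le_mul_of_nonneg_left (h x) (by positivity)
        have h2 : (p x - U / b * mu x) * w x ≤ (p x - U / b * mu x) * V :=
          mul_le_mul_of_nonneg_left (hwV x).2 (by linarith)
        have h3 : U / b * mu x * z x ≤ p x * z x := mul_le_mul_of_nonneg_right hle hz0
        have h4 : (p x - U / b * mu x) * V ≤ U / b * max (muhat x - mu x) 0 * V := by
          refine mul_le_mul_of_nonneg_right ?_ hV
          have : U / b * (muhat x - mu x) ≤ U / b * max (muhat x - mu x) 0 :=
            mul_le_mul_of_nonneg_left (le_max_left _ _) hC
          have := hpU x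
          linarith [mul_sub (U / b) (muhat x) (mu x)]
        linarith
    · rw [Set.indicator_of_notMem hx, mul_zero]
      positivity
  have I5 : Integrable (fun x => U / b * (mu x * r x) + U / b * V * max (muhat x - mu x) 0) ν :=
    (I2.const_mul _).add (I3.const_mul _)
  rw [integral_add I5 I4, integral_add (I2.const_mul _) (I3.const_mul _), integral_const_mul,
    integral_const_mul] at key
  have htv := mul_le_mul_of_nonneg_left (integral_posPart_sub_le_tvDist hmuhat hmu)
    (mul_nonneg hC hV)
  linarith

/-- A law with bounded density rarely visits the pairs where `mu` is large but `muhat` is small. -/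
lemma measureReal_muhat_lt_le {m : Measure (S × A)} [IsProbabilityMeasure m]
    (hm : HasDensityLE ν U m) (hmu : IsProbDensity ν mu) (hmuhat : IsProbDensity ν muhat)
    (hb : 0 < b) :
    m.real {x | muhat x < b} ≤ m.real {x | mu x ≤ 2 * b} +
      U / b * tvDist (densityMeasure ν muhat) (densityMeasure ν mu) := by
  have hU := hm.nonneg
  have hB : MeasurableSet ({x | 2 * b < mu x} ∩ {x | muhat x < b}) :=
    (measurableSet_lt measurable_const hmu.measurable).inter
      (measurableSet_lt hmuhat.measurable measurable_const)
  have hsub : {x | muhat x < b} ⊆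
      {x | mu x ≤ 2 * b} ∪ ({x | 2 * b < mu x} ∩ {x | muhat x < b}) := by
    intro x hx
    rcases le_or_gt (mu x) (2 * b) with h | h
    · exact Or.inl h
    · exact Or.inr ⟨h, hx⟩
  refine (measureReal_mono hsub).trans ((measureReal_union_le _ _).trans ?_)
  refine add_le_add_right ?_ _
  obtain ⟨p, hp, hpU, rfl⟩ := hm.exists_isProbDensity
  rw [hp.measureReal hB, ← integral_indicator hB, tvDist_comm]
  refine le_trans ?_ (mul_le_mul_of_nonneg_left (integral_posPart_sub_le_tvDist hmu hmuhat)
    (div_nonneg hU hb.le))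
  rw [← integral_const_mul]
  refine integral_mono (hp.integrable.indicator hB)
    ((integrable_posPart_sub hmu hmuhat).const_mul _) fun x => ?_
  simp only
  by_cases hx : x ∈ {x | 2 * b < mu x} ∩ {x | muhat x < b}
  · rw [Set.indicator_of_mem hx]
    have h1 : 2 * b < mu x := hx.1
    have h2 : muhat x < b := hx.2
    -- On this set `mu - muhat` exceeds `b`; the gap between the thresholds `2 * b` and `b` is what
    -- makes the total variation applicable.
    refine (hpU x).trans ?_
    rw [div_mul_eq_mul_div, le_div_iff₀ hb]
    exact mul_le_mul_of_nonneg_left (le_trans (by linarith) (le_max_left _ _)) hU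
  · rw [Set.indicator_of_notMem hx]
    exact mul_nonneg (div_nonneg hU hb.le) (le_max_right _ _)

end ChangeOfMeasure

/-- The error after `k` iterations when each iteration adds `K`. -/
def accumulatedError (γ K V : ℝ) : ℕ → ℝ
  | 0 => V
  | k + 1 => K + γ * accumulatedError γ K V k

lemma accumulatedError_le {γ K V : ℝ} (hγ : 0 ≤ γ) (hγ1 : γ < 1) (hK : 0 ≤ K) (k : ℕ) :
    accumulatedError γ K V k ≤ K / (1 - γ) + γ ^ k * V := by
  have h1 : 0 < 1 - γ := by linarith
  induction k with
  | zero =>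
    have : 0 ≤ K / (1 - γ) := by positivity
    simp only [accumulatedError, pow_zero, one_mul]
    linarith
  | succ k ih =>
    have h2 := mul_le_mul_of_nonneg_left ih hγ
    have h3 : K + γ * (K / (1 - γ)) = K / (1 - γ) := by field_simp; ring
    rw [accumulatedError, pow_succ']
    linarith

/-! ### Error propagation and the deterministic performance guarantee. -/

section Performance

variable {S A : Type*} [MeasurableSpace S] [MeasurableSpace A] {M : MDP S A}
  {ν : Measure (S × A)} {mu muhat : S × A → ℝ} {b U V epsMu : ℝ}

lemma abs_sub_mem_Icc {X : Type*} {f g : X → ℝ} (hf : ∀ x, 0 ≤ f x ∧ f x ≤ V)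
    (hg : ∀ x, 0 ≤ g x ∧ g x ≤ V) (x : X) : 0 ≤ |f x - g x| ∧ |f x - g x| ≤ V :=
  ⟨abs_nonneg _, abs_le.2 ⟨by linarith [(hf x).1, (hg x).2], by linarith [(hf x).2, (hg x).1]⟩⟩

/-- One step of error propagation along a reachable law. -/
lemma integral_filtered_le_of_le_add (hU : ∀ π h, HasDensityLE ν U (M.eta π h))
    (hmu : IsProbDensity ν mu) (hmuhat : IsProbDensity ν muhat) (hb : 0 < b) (hV : 0 ≤ V)
    (htv : tvDist (densityMeasure ν muhat) (densityMeasure ν mu) ≤ epsMu)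
    {m : Measure (S × A)} (hm : Reachable M m) {w r : S × A → ℝ} {z : S → ℝ}
    (hw : Measurable w) (hr : Measurable r) (hz : Measurable z) {R Z : ℝ}
    (hwV : ∀ x, 0 ≤ w x ∧ w x ≤ V) (hrR : ∀ x, 0 ≤ r x ∧ r x ≤ R)
    (hzZ : ∀ x, 0 ≤ z x ∧ z x ≤ Z) (h : ∀ x, w x ≤ r x + M.γ * ∫ s, z s ∂M.P x) :
    ∫ x, filtered muhat b w x ∂m ≤ U / b * ∫ x, r x ∂densityMeasure ν mu +
      U / b * (V * epsMu) + M.γ * ∫ x, ∫ s, z s ∂M.P x ∂m := by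
  have := hm.isProbabilityMeasure
  have hmU : HasDensityLE ν U m := by obtain ⟨π, k, rfl⟩ := hm; exact hU π k
  have hγ := M.γ_nonneg
  have hzI : ∀ x, 0 ≤ M.γ * ∫ s, z s ∂M.P x ∧ M.γ * ∫ s, z s ∂M.P x ≤ M.γ * Z := fun x =>
    ⟨mul_nonneg hγ (integral_nonneg fun s => (hzZ s).1), mul_le_mul_of_nonneg_left
      ((le_abs_self _).trans (abs_integral_le_of_abs_le fun s => abs_le_of_mem_Icc (hzZ s))) hγ⟩
  have key := integral_filtered_le hmU hmu hmuhat hb hV hw hr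
    ((measurable_integral_kernel (κ := M.P) hz).const_mul M.γ) hwV hrR hzI h
  rw [integral_const_mul] at key
  have h2 : U / b * (V * tvDist (densityMeasure ν muhat) (densityMeasure ν mu)) ≤
      U / b * (V * epsMu) :=
    mul_le_mul_of_nonneg_left (mul_le_mul_of_nonneg_left htv hV) (div_nonneg hmU.nonneg hb.le)
  linarith

lemma integral_initial_eq (π : Policy S A) {f : S × A → ℝ} (hf : Measurable f) {C : ℝ}
    (hC : ∀ x, |f x| ≤ C) :
    ∫ x, f x ∂(M.ρ ⊗ₘ π.kernel) = ∫ s, ∫ a, f (s, a) ∂π.kernel s ∂M.ρ :=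
  Measure.integral_compProd (integrable_of_measurable_of_abs_le hf hC)

variable [MeasurableSingletonClass A]

lemma integral_ofFun (g : S → A) (hg : Measurable g) (s : S) (f : A → ℝ) :
    ∫ a, f a ∂(Policy.ofFun g hg).kernel s = f (g s) :=
  Kernel.integral_deterministic hg

lemma V_ofFun (g : S → A) (hg : Measurable g) (s : S) :
    M.V (Policy.ofFun g hg) s = M.Q (Policy.ofFun g hg) (s, g s) :=
  integral_ofFun g hg s _

/-- The pair formed by the next state and the action of `g` there has again a reachable law, so a
bound uniform over reachable laws applies to it. -/
lemma integral_step_ofFun_le {m : Measure (S × A)} (hm : Reachable M m) (g : S → A)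
    (hg : Measurable g) {f : S × A → ℝ} (hf : Measurable f) {C K : ℝ} (hC : ∀ x, |f x| ≤ C)
    (hK : ∀ m, Reachable M m → ∫ x, f x ∂m ≤ K) :
    ∫ x, ∫ s, f (s, g s) ∂M.P x ∂m ≤ K := by
  have := hm.isProbabilityMeasure
  have h := hK _ (hm.step (Policy.ofFun g hg))
  rw [integral_step_comp M _ m hf hC] at h
  simpa only [integral_ofFun] using h

lemma integral_initial_ofFun_le (g : S → A)
    (hg : Measurable g) {f : S × A → ℝ} (hf : Measurable f) {C K : ℝ} (hC : ∀ x, |f x| ≤ C)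
    (hK : ∀ m, Reachable M m → ∫ x, f x ∂m ≤ K) :
    ∫ s, f (s, g s) ∂M.ρ ≤ K := by
  have h := hK _ (reachable_initial M (Policy.ofFun g hg))
  rw [integral_initial_eq _ hf hC] at h
  simpa only [integral_ofFun] using h

variable [Countable A]

/-- The amount by which the last iterate overestimates the value of its greedy policy. -/
lemma integral_filtered_posPart_sub_Q_le (hR : ∀ x, ∀ᵐ r ∂(M.R x), |r| ≤ V)
    (hQ : ∀ (π : Policy S A) x, 0 ≤ M.Q π x ∧ M.Q π x ≤ V)
    (hU : ∀ π h, HasDensityLE ν U (M.eta π h)) (hmu : IsProbDensity ν mu)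
    (hmuhat : IsProbDensity ν muhat) (hb : 0 < b) (hV : 0 ≤ V)
    (htv : tvDist (densityMeasure ν muhat) (densityMeasure ν mu) ≤ epsMu)
    {f f' : S × A → ℝ} (hf : Measurable f) (hf' : Measurable f')
    (hfV : ∀ x, 0 ≤ f x ∧ f x ≤ V) (hfV' : ∀ x, 0 ≤ f' x ∧ f' x ≤ V) {d D : ℝ}
    (hd : l2norm (densityMeasure ν mu) (fun x => f' x - M.bellman muhat b f x) ≤ d)
    (hD : ∀ m, Reachable M m →
      ∫ x, ∫ s, |maxFiltered muhat b f s - maxFiltered muhat b f' s| ∂M.P x ∂m ≤ D)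
    {g : S → A} (hg : Measurable g)
    (hgreedy : ∀ s a, filtered muhat b f' (s, a) ≤ filtered muhat b f' (s, g s))
    {m : Measure (S × A)} (hm : Reachable M m) :
    ∫ x, filtered muhat b (fun x => max (f' x - M.Q (Policy.ofFun g hg) x) 0) x ∂m ≤
      (U / b * (d + V * epsMu) + M.γ * D) / (1 - M.γ) := by
  have := hmu.isProbabilityMeasure
  set q := M.Q (Policy.ofFun g hg) with hq_def
  set w : S × A → ℝ := fun x => max (f' x - q x) 0 with hw_def
  have hqm : Measurable q := measurable_Q _
  have hqV := hQ (Policy.ofFun g hg)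
  have hwm : Measurable w := (hf'.sub hqm).max measurable_const
  have hwV : ∀ x, 0 ≤ w x ∧ w x ≤ V := fun x =>
    ⟨le_max_right _ _, max_le (by linarith [(hfV' x).2, (hqV x).1]) hV⟩
  have hγ := M.γ_nonneg
  have hγ1 : 0 < 1 - M.γ := by linarith [M.γ_lt_one]
  have hU0 : 0 ≤ U / b := by
    obtain ⟨π, h, rfl⟩ := hm
    exact div_nonneg (hU π h).nonneg hb.le
  have hTf := measurable_bellman (M := M) (b := b) hmuhat.measurable hf
  have hTfV := abs_bellman_le (muhat := muhat) (b := b) hR hV hfV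
  have hdV : ∀ x, |f' x - M.bellman muhat b f x| ≤ 3 * V := fun x => by
    have h1 := abs_le.1 (hTfV x)
    exact abs_le.2 ⟨by linarith [(hfV' x).1], by linarith [(hfV' x).2]⟩
  have hdm := hf'.sub hTf
  have hWm := measurable_maxFiltered (b := b) hmuhat.measurable hf
  have hWm' := measurable_maxFiltered (b := b) hmuhat.measurable hf'
  have hWV := fun s => maxFiltered_mem_Icc (muhat := muhat) (b := b) hV hfV s
  have hWV' := fun s => maxFiltered_mem_Icc (muhat := muhat) (b := b) hV hfV' s
  have hfwm := measurable_filtered (b := b) hmuhat.measurable hwm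
  have hfwV := fun x => filtered_mem_Icc (muhat := muhat) (b := b) hV hwV x
  have hgw : Measurable fun s => filtered muhat b w (s, g s) :=
    hfwm.comp (measurable_id.prodMk hg)
  have hWd : Measurable fun s => |maxFiltered muhat b f s - maxFiltered muhat b f' s| :=
    (hWm.sub hWm').abs
  have hWdV := abs_sub_mem_Icc hWV hWV'
  have hmax : ∀ s, maxFiltered muhat b f' s = filtered muhat b f' (s, g s) := fun s =>
    le_antisymm (have : Nonempty A := ⟨g s⟩; ciSup_le (hgreedy s))
      (filtered_le_maxFiltered hV hfV' s _)
  have hVm : Measurable (M.V (Policy.ofFun g hg)) := measurable_V _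
  have hVV : ∀ s, |M.V (Policy.ofFun g hg) s| ≤ V := fun s => by
    rw [V_ofFun]; exact abs_le_of_mem_Icc (hqV _)
  -- If the greedy action is filtered out, the maximum of `f'` is `0`, and nonnegativity of `Q`
  -- makes the overestimation harmless. Thus only filtered errors enter.
  have hpt : ∀ s, maxFiltered muhat b f s - M.V (Policy.ofFun g hg) s ≤
      |maxFiltered muhat b f s - maxFiltered muhat b f' s| + filtered muhat b w (s, g s) := by
    intro s
    have h1 := le_abs_self (maxFiltered muhat b f s - maxFiltered muhat b f' s)
    have h2 : maxFiltered muhat b f' s - M.V (Policy.ofFun g hg) s ≤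
        filtered muhat b w (s, g s) := by
      rw [hmax, V_ofFun]
      unfold filtered
      by_cases h : (s, g s) ∈ {y | b ≤ muhat y}
      · rw [Set.indicator_of_mem h, Set.indicator_of_mem h]
        exact le_max_left _ _
      · rw [Set.indicator_of_notMem h, Set.indicator_of_notMem h]
        linarith [(hqV (s, g s)).1]
    linarith
  have hrec : ∀ x, w x ≤ |f' x - M.bellman muhat b f x| + M.γ *
      ∫ s, (|maxFiltered muhat b f s - maxFiltered muhat b f' s| +
        filtered muhat b w (s, g s)) ∂M.P x := by
    intro x
    have hI : Integrable (maxFiltered muhat b f) (M.P x) :=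
      integrable_of_measurable_of_abs_le hWm fun s => abs_le_of_mem_Icc (hWV s)
    have hIV : Integrable (M.V (Policy.ofFun g hg)) (M.P x) :=
      integrable_of_measurable_of_abs_le hVm hVV
    have h1 : ∫ s, (maxFiltered muhat b f s - M.V (Policy.ofFun g hg) s) ∂M.P x ≤
        ∫ s, (|maxFiltered muhat b f s - maxFiltered muhat b f' s| +
          filtered muhat b w (s, g s)) ∂M.P x :=
      integral_mono (hI.sub hIV)
        ((integrable_of_measurable_of_abs_le hWd fun s => abs_le_of_mem_Icc (hWdV s)).add
          (integrable_of_measurable_of_abs_le hgw fun s => abs_le_of_mem_Icc (hfwV _))) hpt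
    rw [integral_sub hI hIV] at h1
    have h2 := mul_le_mul_of_nonneg_left h1 hγ
    have h3 := bellman_equation hR (Policy.ofFun g hg) (fun x => abs_le_of_mem_Icc (hqV x)) x
    have h4 := le_abs_self (f' x - M.bellman muhat b f x)
    have h5 : M.bellman muhat b f x - q x = M.γ * (∫ s, maxFiltered muhat b f s ∂M.P x -
        ∫ s, M.V (Policy.ofFun g hg) s ∂M.P x) := by
      rw [hq_def, h3]; unfold MDP.bellman; ring
    refine max_le (by linarith) (add_nonneg (abs_nonneg _) (mul_nonneg hγ ?_))
    exact integral_nonneg fun s => add_nonneg (hWdV s).1 (hfwV _).1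
  set E := U / b * (d + V * epsMu) + M.γ * D with hE
  -- The recursion bounds the filtered integral of `w` by `E` plus `γ` times the same kind of
  -- integral; `E / (1 - γ)` is the fixed point of this map.
  have hfix : E + M.γ * (E / (1 - M.γ)) = E / (1 - M.γ) := by field_simp; ring
  have hD0 : 0 ≤ D := le_trans
    (integral_nonneg fun x => integral_nonneg fun s => (hWdV s).1) (hD m hm)
  have heps : 0 ≤ epsMu := (tvDist_nonneg _ _).trans htv
  have hd0 : 0 ≤ d := (Real.sqrt_nonneg _).trans hd
  have hE0 : 0 ≤ E := by positivity
  -- The law changes at each unrolling, so the induction is uniform over reachable laws. It starts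
  -- from the trivial bound `V`, whose contribution `γ ^ j * V` vanishes in the limit.
  have hiter : ∀ j : ℕ, ∀ m, Reachable M m →
      ∫ x, filtered muhat b w x ∂m ≤ E / (1 - M.γ) + M.γ ^ j * V := by
    intro j
    induction j with
    | zero =>
      intro m hm
      have := hm.isProbabilityMeasure
      have h1 : ∫ x, filtered muhat b w x ∂m ≤ V :=
        (le_abs_self _).trans (abs_integral_le_of_abs_le fun x => abs_le_of_mem_Icc (hfwV x))
      have h2 : 0 ≤ E / (1 - M.γ) := by positivity
      rw [pow_zero, one_mul]
      linarith
    | succ j ih =>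
      intro m hm
      have := hm.isProbabilityMeasure
      have key := integral_filtered_le_of_le_add hU hmu hmuhat hb hV htv hm hwm hdm.abs
        (hWd.add hgw) hwV (fun x => ⟨abs_nonneg _, hdV x⟩) (Z := 2 * V)
        (fun s => ⟨add_nonneg (hWdV s).1 (hfwV _).1, by
          simp only [Pi.add_apply]; linarith [(hWdV s).2, (hfwV (s, g s)).2]⟩) hrec
      have h1 : ∫ x, ∫ s, (|maxFiltered muhat b f s - maxFiltered muhat b f' s| +
          filtered muhat b w (s, g s)) ∂M.P x ∂m ≤ D + (E / (1 - M.γ) + M.γ ^ j * V) := by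
        have hs : ∀ x, ∫ s, (|maxFiltered muhat b f s - maxFiltered muhat b f' s| +
            filtered muhat b w (s, g s)) ∂M.P x =
            ∫ s, |maxFiltered muhat b f s - maxFiltered muhat b f' s| ∂M.P x +
              ∫ s, filtered muhat b w (s, g s) ∂M.P x := fun x =>
          integral_add (integrable_of_measurable_of_abs_le hWd fun s => abs_le_of_mem_Icc (hWdV s))
            (integrable_of_measurable_of_abs_le hgw fun s => abs_le_of_mem_Icc (hfwV _))
        simp_rw [hs]
        rw [integral_add (integrable_of_measurable_of_abs_le (measurable_integral_kernel hWd)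
            fun x => abs_integral_le_of_abs_le fun s => abs_le_of_mem_Icc (hWdV s))
          (integrable_of_measurable_of_abs_le (measurable_integral_kernel hgw)
            fun x => abs_integral_le_of_abs_le fun s => abs_le_of_mem_Icc (hfwV _))]
        exact add_le_add (hD m hm) (integral_step_ofFun_le hm g hg hfwm
          (fun x => abs_le_of_mem_Icc (hfwV x)) ih)
      have h2 := mul_le_mul_of_nonneg_left h1 hγ
      have h3 := mul_le_mul_of_nonneg_left ((integral_abs_le_l2norm hdm hdV).trans hd) hU0
      rw [pow_succ']
      simp only [Pi.add_apply] at key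
      linarith
  have hlim : Filter.Tendsto (fun j : ℕ => E / (1 - M.γ) + M.γ ^ j * V) Filter.atTop
      (nhds (E / (1 - M.γ) + 0 * V)) :=
    ((tendsto_pow_atTop_nhds_zero_of_lt_one hγ M.γ_lt_one).mul_const V).const_add _
  rw [zero_mul, add_zero] at hlim
  exact ge_of_tendsto' hlim fun j => hiter j m hm

variable [Nonempty A]

/-- An action rule that attains the filtered maximum up to `α` is a policy, so the maximum reduces
to a filtered integral against a reachable law; then `α` tends to `0`. -/
lemma integral_step_maxFiltered_le (hmuhat : Measurable muhat) (hV : 0 ≤ V) {m : Measure (S × A)}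
    (hm : Reachable M m) {u : S × A → ℝ} (hu : Measurable u) (huV : ∀ x, 0 ≤ u x ∧ u x ≤ V)
    {K : ℝ} (hK : ∀ m, Reachable M m → ∫ x, filtered muhat b u x ∂m ≤ K) :
    ∫ x, ∫ s, maxFiltered muhat b u s ∂M.P x ∂m ≤ K := by
  have := hm.isProbabilityMeasure
  refine le_of_forall_pos_le_add fun α hα => ?_
  obtain ⟨g, hg, hgα⟩ := exists_measurable_near_maximizer (b := b) hmuhat hu hα
  have hfm := measurable_filtered (b := b) hmuhat hu
  have hfV : ∀ x, |filtered muhat b u x| ≤ V := fun x =>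
    abs_le_of_mem_Icc (filtered_mem_Icc hV huV x)
  have hWm := measurable_maxFiltered (b := b) hmuhat hu
  have hWV : ∀ s, |maxFiltered muhat b u s| ≤ V := fun s =>
    abs_le_of_mem_Icc (maxFiltered_mem_Icc hV huV s)
  have hgm : Measurable fun s => filtered muhat b u (s, g s) :=
    hfm.comp (measurable_id.prodMk hg)
  have h1 := integral_step_ofFun_le hm g hg hfm hfV hK
  have h2 : ∫ x, ∫ s, maxFiltered muhat b u s ∂M.P x ∂m ≤
      ∫ x, (∫ s, filtered muhat b u (s, g s) ∂M.P x + α) ∂m := by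
    have hI : Integrable (fun x => ∫ s, filtered muhat b u (s, g s) ∂M.P x) m :=
      integrable_of_measurable_of_abs_le (measurable_integral_kernel hgm)
        fun x => abs_integral_le_of_abs_le fun s => hfV _
    refine integral_mono (integrable_of_measurable_of_abs_le (measurable_integral_kernel hWm)
      fun x => abs_integral_le_of_abs_le hWV) (hI.add (integrable_const α)) fun x => ?_
    have hIx : Integrable (fun s => filtered muhat b u (s, g s)) (M.P x) :=
      integrable_of_measurable_of_abs_le hgm fun s => hfV _
    have h3 : ∫ s, maxFiltered muhat b u s ∂M.P x ≤
        ∫ s, (filtered muhat b u (s, g s) + α) ∂M.P x :=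
      integral_mono (integrable_of_measurable_of_abs_le hWm hWV)
        (hIx.add (integrable_const α)) hgα
    rwa [integral_add hIx (integrable_const _), integral_const, probReal_univ, one_smul] at h3
  rw [integral_add (integrable_of_measurable_of_abs_le (measurable_integral_kernel hgm)
        fun x => abs_integral_le_of_abs_le fun s => hfV _) (integrable_const _), integral_const,
    probReal_univ, one_smul] at h2
  linarith

lemma integral_initial_maxFiltered_le (hmuhat : Measurable muhat) (hV : 0 ≤ V)
    {u : S × A → ℝ} (hu : Measurable u) (huV : ∀ x, 0 ≤ u x ∧ u x ≤ V)
    {K : ℝ} (hK : ∀ m, Reachable M m → ∫ x, filtered muhat b u x ∂m ≤ K) :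
    ∫ s, maxFiltered muhat b u s ∂M.ρ ≤ K := by
  refine le_of_forall_pos_le_add fun α hα => ?_
  obtain ⟨g, hg, hgα⟩ := exists_measurable_near_maximizer (b := b) hmuhat hu hα
  have hfm := measurable_filtered (b := b) hmuhat hu
  have hfV : ∀ x, |filtered muhat b u x| ≤ V := fun x =>
    abs_le_of_mem_Icc (filtered_mem_Icc hV huV x)
  have hI : Integrable (fun s => filtered muhat b u (s, g s)) M.ρ :=
    integrable_of_measurable_of_abs_le (hfm.comp (measurable_id.prodMk hg)) fun s => hfV _
  have h1 := integral_initial_ofFun_le g hg hfm hfV hK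
  have h2 : ∫ s, maxFiltered muhat b u s ∂M.ρ ≤
      ∫ s, (filtered muhat b u (s, g s) + α) ∂M.ρ :=
    integral_mono (integrable_of_measurable_of_abs_le (measurable_maxFiltered hmuhat hu)
        fun s => abs_le_of_mem_Icc (maxFiltered_mem_Icc hV huV s))
      (hI.add (integrable_const α)) hgα
  rw [integral_add hI (integrable_const _), integral_const, probReal_univ, one_smul] at h2
  linarith

/-- Error propagation of approximate value iteration, measured along reachable laws. -/
lemma integral_filtered_abs_sub_le (hR : ∀ x, ∀ᵐ r ∂(M.R x), |r| ≤ V)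
    (hU : ∀ π h, HasDensityLE ν U (M.eta π h)) (hmu : IsProbDensity ν mu)
    (hmuhat : IsProbDensity ν muhat) (hb : 0 < b) (hV : 0 ≤ V)
    (htv : tvDist (densityMeasure ν muhat) (densityMeasure ν mu) ≤ epsMu)
    {q : S × A → ℝ} (hq : Measurable q) (hqV : ∀ x, 0 ≤ q x ∧ q x ≤ V)
    {f : ℕ → S × A → ℝ} {t : ℕ} (hf : ∀ k ≤ t, Measurable (f k))
    (hfV : ∀ k ≤ t, ∀ x, 0 ≤ f k x ∧ f k x ≤ V) {d : ℝ}
    (hd : ∀ k < t, l2norm (densityMeasure ν mu)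
      (fun x => f (k + 1) x - M.bellman muhat b (f k) x) ≤ d) :
    ∀ k ≤ t, ∀ m, Reachable M m → ∫ x, filtered muhat b (fun x => |q x - f k x|) x ∂m ≤
      accumulatedError M.γ (U / b * (d + V * epsMu + l2norm (densityMeasure ν mu)
        (fun x => q x - M.bellman muhat b q x))) V k := by
  have := hmu.isProbabilityMeasure
  intro k
  induction k with
  | zero =>
    intro hk m hm
    have := hm.isProbabilityMeasure
    exact (le_abs_self _).trans (abs_integral_le_of_abs_le fun x =>
      abs_le_of_mem_Icc (filtered_mem_Icc hV (abs_sub_mem_Icc hqV (hfV 0 hk)) x))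
  | succ k ih =>
    intro hk m hm
    have := hm.isProbabilityMeasure
    have hk' : k ≤ t := by omega
    have hU0 : 0 ≤ U / b := by
      obtain ⟨π, h, rfl⟩ := hm
      exact div_nonneg (hU π h).nonneg hb.le
    have hTq := measurable_bellman (M := M) (b := b) hmuhat.measurable hq
    have hTf := measurable_bellman (M := M) (b := b) hmuhat.measurable (hf k hk')
    have hTqV := abs_bellman_le (muhat := muhat) (b := b) hR hV hqV
    have hTfV := abs_bellman_le (muhat := muhat) (b := b) hR hV (hfV k hk')
    have hWqm := measurable_maxFiltered (b := b) hmuhat.measurable hq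
    have hWfm := measurable_maxFiltered (b := b) hmuhat.measurable (hf k hk')
    have hWq := fun s => maxFiltered_mem_Icc (muhat := muhat) (b := b) hV hqV s
    have hWf := fun s => maxFiltered_mem_Icc (muhat := muhat) (b := b) hV (hfV k hk') s
    have hresV : ∀ x, |q x - M.bellman muhat b q x| ≤ 3 * V := fun x => by
      have h1 := abs_le.1 (hTqV x)
      exact abs_le.2 ⟨by linarith [(hqV x).1], by linarith [(hqV x).2]⟩
    have hdV : ∀ x, |f (k + 1) x - M.bellman muhat b (f k) x| ≤ 3 * V := fun x => by
      have h1 := abs_le.1 (hTfV x)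
      exact abs_le.2 ⟨by linarith [(hfV (k + 1) hk x).1], by linarith [(hfV (k + 1) hk x).2]⟩
    have hresm : Measurable fun x => q x - M.bellman muhat b q x := hq.sub hTq
    have hdm : Measurable fun x => f (k + 1) x - M.bellman muhat b (f k) x :=
      (hf (k + 1) hk).sub hTf
    have key := integral_filtered_le_of_le_add hU hmu hmuhat hb hV htv hm
      (w := fun x => |q x - f (k + 1) x|)
      (r := fun x => |q x - M.bellman muhat b q x| + |f (k + 1) x - M.bellman muhat b (f k) x|)
      (z := maxFiltered muhat b (fun x => |q x - f k x|))
      (hq.sub (hf (k + 1) hk)).abs (hresm.abs.add hdm.abs)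
      (measurable_maxFiltered hmuhat.measurable (hq.sub (hf k hk')).abs) (R := 6 * V)
      (abs_sub_mem_Icc hqV (hfV (k + 1) hk))
      (fun x => ⟨by positivity, by linarith [hresV x, hdV x]⟩)
      (fun s => maxFiltered_mem_Icc hV (abs_sub_mem_Icc hqV (hfV k hk')) s)
      (fun x => by
        have h1 : M.bellman muhat b q x - M.bellman muhat b (f k) x =
            M.γ * ∫ s, (maxFiltered muhat b q s - maxFiltered muhat b (f k) s) ∂M.P x := by
          rw [integral_sub (integrable_of_measurable_of_abs_le hWqm
              fun s => abs_le_of_mem_Icc (hWq s))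
            (integrable_of_measurable_of_abs_le hWfm fun s => abs_le_of_mem_Icc (hWf s))]
          unfold MDP.bellman
          ring
        have h2 : |∫ s, (maxFiltered muhat b q s - maxFiltered muhat b (f k) s) ∂M.P x| ≤
            ∫ s, maxFiltered muhat b (fun x => |q x - f k x|) s ∂M.P x := by
          refine (abs_integral_le_integral_abs).trans ?_
          refine integral_mono
            (integrable_of_measurable_of_abs_le (hWqm.sub hWfm).abs (C := V) fun s => ?_)
            (integrable_of_measurable_of_abs_le
              (measurable_maxFiltered hmuhat.measurable (hq.sub (hf k hk')).abs)
              fun s => abs_le_of_mem_Icc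
                (maxFiltered_mem_Icc hV (abs_sub_mem_Icc hqV (hfV k hk')) s))
            (abs_maxFiltered_sub_le hV hqV (hfV k hk'))
          rw [abs_abs]
          exact (abs_sub_mem_Icc hWq hWf s).2
        have h3 := mul_le_mul_of_nonneg_left h2 M.γ_nonneg
        rw [← abs_of_nonneg M.γ_nonneg, ← abs_mul, abs_of_nonneg M.γ_nonneg, ← h1] at h3
        -- The first two terms are integrated against `mu` after the change of measure; the third is
        -- the contracted previous error and stays on the reachable law.
        have h4 : q x - f (k + 1) x = (q x - M.bellman muhat b q x) -
          (f (k + 1) x - M.bellman muhat b (f k) x) +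
          (M.bellman muhat b q x - M.bellman muhat b (f k) x) := by ring
        rw [h4]
        refine (abs_add_le _ _).trans (add_le_add (abs_sub _ _) h3))
    refine key.trans ?_
    have hstep := integral_step_maxFiltered_le (b := b) hmuhat.measurable hV hm
      (hq.sub (hf k hk')).abs (abs_sub_mem_Icc hqV (hfV k hk')) (ih hk')
    have h1 := mul_le_mul_of_nonneg_left hstep M.γ_nonneg
    have h2 : ∫ x, (|q x - M.bellman muhat b q x| +
        |f (k + 1) x - M.bellman muhat b (f k) x|) ∂densityMeasure ν mu ≤
        l2norm (densityMeasure ν mu) (fun x => q x - M.bellman muhat b q x) + d := by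
      rw [integral_add
        (integrable_of_measurable_of_abs_le hresm.abs fun x => (abs_abs _).trans_le (hresV x))
        (integrable_of_measurable_of_abs_le hdm.abs fun x => (abs_abs _).trans_le (hdV x))]
      exact add_le_add (integral_abs_le_l2norm hresm hresV)
        ((integral_abs_le_l2norm hdm hdV).trans (hd k (by omega)))
    have h3 := mul_le_mul_of_nonneg_left h2 hU0
    rw [accumulatedError]
    simp only [Pi.sub_apply] at h1
    linarith

/-- The performance guarantee when all regression errors are at most `d`. -/
lemma value_le_value_ofFun_add (hR : ∀ x, ∀ᵐ r ∂(M.R x), |r| ≤ V)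
    (hQ : ∀ (π : Policy S A) x, 0 ≤ M.Q π x ∧ M.Q π x ≤ V)
    (hU : ∀ π h, HasDensityLE ν U (M.eta π h)) (hmu : IsProbDensity ν mu)
    (hmuhat : IsProbDensity ν muhat) (hb : 0 < b) (hV : 0 ≤ V)
    (htv : tvDist (densityMeasure ν muhat) (densityMeasure ν mu) ≤ epsMu)
    (πstar : Policy S A) {ε : ℝ}
    (hstar : (M.eta (fun _ => πstar) 0).real {x | mu x ≤ 2 * b} ≤ ε / (1 - M.γ))
    {f : ℕ → S × A → ℝ} {k : ℕ} (hf : ∀ j ≤ k + 1, Measurable (f j))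
    (hfV : ∀ j ≤ k + 1, ∀ x, 0 ≤ f j x ∧ f j x ≤ V) {d : ℝ}
    (hd : ∀ j < k + 1, l2norm (densityMeasure ν mu)
      (fun x => f (j + 1) x - M.bellman muhat b (f j) x) ≤ d)
    {g : S → A} (hg : Measurable g)
    (hgreedy : ∀ s a, filtered muhat b (f (k + 1)) (s, a) ≤
      filtered muhat b (f (k + 1)) (s, g s)) :
    M.value πstar ≤ M.value (Policy.ofFun g hg) +
      (2 * (U / b) * (d + V * epsMu + l2norm (densityMeasure ν mu)
        (fun x => M.Q πstar x - M.bellman muhat b (M.Q πstar) x)) / (1 - M.γ) ^ 2 +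
      (2 * M.γ ^ (k + 1) + (ε + U / b * epsMu)) * V / (1 - M.γ)) := by
  set res := l2norm (densityMeasure ν mu)
    (fun x => M.Q πstar x - M.bellman muhat b (M.Q πstar) x) with hres
  set q := M.Q πstar with hq_def
  have hqm : Measurable q := measurable_Q _
  have hqV := hQ πstar
  have hγ := M.γ_nonneg
  have hγ1 : 0 < 1 - M.γ := by linarith [M.γ_lt_one]
  have hC : 0 ≤ U / b := div_nonneg (hU (fun _ => πstar) 0).nonneg hb.le
  have heps : 0 ≤ epsMu := (tvDist_nonneg _ _).trans htv
  have hd0 : 0 ≤ d := (Real.sqrt_nonneg _).trans (hd 0 (by omega))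
  have hres0 : 0 ≤ res := Real.sqrt_nonneg _
  have hW := fun s => maxFiltered_mem_Icc (muhat := muhat) (b := b) hV hqV s
  have hWm := measurable_maxFiltered (b := b) hmuhat.measurable hqm
  have hWf := fun j hj s => maxFiltered_mem_Icc (muhat := muhat) (b := b) hV (hfV j hj) s
  have hWfm := fun j hj => measurable_maxFiltered (b := b) hmuhat.measurable (hf j hj)
  have hA := integral_filtered_abs_sub_le hR hU hmu hmuhat hb hV htv hqm hqV hf hfV hd
  rw [← hres] at hA
  set K := U / b * (d + V * epsMu + res) with hK
  have hK0 : 0 ≤ K := by positivity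
  set e := accumulatedError M.γ K V with he
  have hdiffm : ∀ j ≤ k + 1, Measurable fun x => |q x - f j x| := fun j hj =>
    (hqm.sub (hf j hj)).abs
  have hdiffV := fun j hj x => abs_sub_mem_Icc hqV (hfV j hj) x
  -- successive iterates are close along reachable laws
  have hD : ∀ m, Reachable M m → ∫ x, ∫ s, |maxFiltered muhat b (f k) s -
      maxFiltered muhat b (f (k + 1)) s| ∂M.P x ∂m ≤ e k + e (k + 1) := by
    intro m hm
    have := hm.isProbabilityMeasure
    have hMm := fun j hj =>
      measurable_maxFiltered (b := b) hmuhat.measurable (hdiffm j hj)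
    have hMV := fun j hj s => abs_le_of_mem_Icc
      (maxFiltered_mem_Icc (muhat := muhat) (b := b) hV (hdiffV j hj) s)
    have hI := fun j hj x => integrable_of_measurable_of_abs_le (m := M.P x) (hMm j hj) (hMV j hj)
    have hII := fun j hj => integrable_of_measurable_of_abs_le (m := m)
      (measurable_integral_kernel (κ := M.P) (hMm j hj))
      fun x => abs_integral_le_of_abs_le (hMV j hj)
    have hk : k ≤ k + 1 := Nat.le_succ k
    have hdm : Measurable fun s =>
        |maxFiltered muhat b (f k) s - maxFiltered muhat b (f (k + 1)) s| :=
      ((hWfm k hk).sub (hWfm (k + 1) le_rfl)).abs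
    have hdV := fun s => abs_le_of_mem_Icc (abs_sub_mem_Icc (hWf k hk) (hWf (k + 1) le_rfl) s)
    have h1 : ∀ x, ∫ s, |maxFiltered muhat b (f k) s -
        maxFiltered muhat b (f (k + 1)) s| ∂M.P x ≤
        ∫ s, maxFiltered muhat b (fun x => |q x - f k x|) s ∂M.P x +
        ∫ s, maxFiltered muhat b (fun x => |q x - f (k + 1) x|) s ∂M.P x := by
      intro x
      rw [← integral_add (hI k hk x) (hI (k + 1) le_rfl x)]
      refine integral_mono (integrable_of_measurable_of_abs_le hdm hdV)
        ((hI k hk x).add (hI (k + 1) le_rfl x)) fun s => ?_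
      have h2 := abs_maxFiltered_sub_le (muhat := muhat) (b := b) hV hqV (hfV k hk) s
      have h3 := abs_maxFiltered_sub_le (muhat := muhat) (b := b) hV hqV (hfV (k + 1) le_rfl) s
      rw [abs_sub_comm] at h2
      exact (abs_sub_le _ (maxFiltered muhat b q s) _).trans (add_le_add h2 h3)
    refine (integral_mono (integrable_of_measurable_of_abs_le (measurable_integral_kernel hdm)
      fun x => abs_integral_le_of_abs_le hdV) ((hII k hk).add (hII (k + 1) le_rfl)) h1).trans ?_
    simp only [Pi.add_apply]
    rw [integral_add (hII k hk) (hII (k + 1) le_rfl)]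
    exact add_le_add
      (integral_step_maxFiltered_le hmuhat.measurable hV hm (hdiffm k hk) (hdiffV k hk) (hA k hk))
      (integral_step_maxFiltered_le hmuhat.measurable hV hm (hdiffm (k + 1) le_rfl)
        (hdiffV (k + 1) le_rfl) (hA (k + 1) le_rfl))
  have hB := fun m hm => integral_filtered_posPart_sub_Q_le hR hQ hU hmu hmuhat hb hV htv
    (hf k (Nat.le_succ k)) (hf (k + 1) le_rfl) (hfV k (Nat.le_succ k)) (hfV (k + 1) le_rfl)
    (hd k (Nat.lt_succ_self k)) hD hg hgreedy (m := m) hm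
  set B := (U / b * (d + V * epsMu) + M.γ * (e k + e (k + 1))) / (1 - M.γ) with hBdef
  set w : S × A → ℝ := fun x => max (f (k + 1) x - M.Q (Policy.ofFun g hg) x) 0 with hw_def
  have hwm : Measurable w := ((hf _ le_rfl).sub (measurable_Q _)).max measurable_const
  have hwV : ∀ x, 0 ≤ w x ∧ w x ≤ V := fun x =>
    ⟨le_max_right _ _, max_le (by
      linarith [(hfV (k + 1) le_rfl x).2, (hQ (Policy.ofFun g hg) x).1]) hV⟩
  have hfwm := measurable_filtered (b := b) hmuhat.measurable hwm
  have hfwV := fun x => filtered_mem_Icc (muhat := muhat) (b := b) hV hwV x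
  -- the filtered maximum of `q` against the value of the output
  have h1 : ∫ s, maxFiltered muhat b q s ∂M.ρ - M.value (Policy.ofFun g hg) ≤ e (k + 1) + B := by
    have hMm := measurable_maxFiltered (b := b) hmuhat.measurable (hdiffm (k + 1) le_rfl)
    have hMI : Integrable (maxFiltered muhat b (fun x => |q x - f (k + 1) x|)) M.ρ :=
      integrable_of_measurable_of_abs_le hMm
        fun s => abs_le_of_mem_Icc (maxFiltered_mem_Icc hV (hdiffV (k + 1) le_rfl) s)
    have hwI : Integrable (fun s => filtered muhat b w (s, g s)) M.ρ :=
      integrable_of_measurable_of_abs_le (hfwm.comp (measurable_id.prodMk hg))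
        fun s => abs_le_of_mem_Icc (hfwV _)
    have hWI : Integrable (maxFiltered muhat b q) M.ρ :=
      integrable_of_measurable_of_abs_le hWm fun s => abs_le_of_mem_Icc (hW s)
    have hVI : Integrable (M.V (Policy.ofFun g hg)) M.ρ :=
      integrable_of_measurable_of_abs_le (measurable_V _) (C := V) fun s => by
        rw [V_ofFun]; exact abs_le_of_mem_Icc (hQ _ _)
    unfold MDP.value
    rw [← integral_sub hWI hVI]
    refine (integral_mono (hWI.sub hVI) (hMI.add hwI) fun s => ?_).trans ?_
    · have h2 := (le_abs_self _).trans
        (abs_maxFiltered_sub_le (muhat := muhat) (b := b) hV hqV (hfV (k + 1) le_rfl) s)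
      have h3 : maxFiltered muhat b (f (k + 1)) s ≤ filtered muhat b (f (k + 1)) (s, g s) :=
        ciSup_le (hgreedy s)
      have h4 : filtered muhat b (f (k + 1)) (s, g s) - M.V (Policy.ofFun g hg) s ≤
          filtered muhat b w (s, g s) := by
        rw [V_ofFun]
        unfold filtered
        by_cases h : (s, g s) ∈ {y | b ≤ muhat y}
        · rw [Set.indicator_of_mem h, Set.indicator_of_mem h]
          exact le_max_left _ _
        · rw [Set.indicator_of_notMem h, Set.indicator_of_notMem h]
          linarith [(hQ (Policy.ofFun g hg) (s, g s)).1]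
      simp only [Pi.add_apply, Pi.sub_apply]
      linarith
    · simp only [Pi.add_apply]
      rw [integral_add hMI hwI]
      exact add_le_add
        (integral_initial_maxFiltered_le hmuhat.measurable hV (hdiffm (k + 1) le_rfl)
          (hdiffV (k + 1) le_rfl) (hA (k + 1) le_rfl))
        (integral_initial_ofFun_le g hg hfwm (fun x => abs_le_of_mem_Icc (hfwV x)) hB)
  -- the value of `πstar` against the filtered maximum of `q`
  have h2 : M.value πstar ≤ V * ((ε + U / b * epsMu) / (1 - M.γ)) +
      ∫ s, maxFiltered muhat b q s ∂M.ρ := by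
    have hfqm := measurable_filtered (b := b) hmuhat.measurable hqm
    have hfqV := fun x => filtered_mem_Icc (muhat := muhat) (b := b) hV hqV x
    have hset : MeasurableSet {x | muhat x < b} :=
      measurableSet_lt hmuhat.measurable measurable_const
    have hval : M.value πstar = ∫ x, q x ∂(M.eta (fun _ => πstar) 0) := by
      rw [eta_zero, integral_initial_eq _ hqm fun x => abs_le_of_mem_Icc (hqV x)]
      rfl
    -- Pairs that the filter removes are charged the maximal value `V`; the rest is kept in
    -- `filtered`.
    have hle : ∫ x, q x ∂(M.eta (fun _ => πstar) 0) ≤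
        ∫ x, ({x | muhat x < b}.indicator (fun _ => V) x + filtered muhat b q x)
          ∂(M.eta (fun _ => πstar) 0) := by
      refine integral_mono (integrable_of_measurable_of_abs_le hqm
        fun x => abs_le_of_mem_Icc (hqV x)) (((integrable_const V).indicator hset).add
        (integrable_of_measurable_of_abs_le hfqm fun x => abs_le_of_mem_Icc (hfqV x))) fun x => ?_
      simp only
      unfold filtered
      rcases lt_or_ge (muhat x) b with h | h
      · rw [Set.indicator_of_mem (show x ∈ {x | muhat x < b} from h),
          Set.indicator_of_notMem (show x ∉ {y | b ≤ muhat y} from not_le.2 h)]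
        linarith [(hqV x).2]
      · rw [Set.indicator_of_notMem (show x ∉ {x | muhat x < b} from not_lt.2 h),
          Set.indicator_of_mem (show x ∈ {y | b ≤ muhat y} from h)]
        linarith
    rw [integral_add ((integrable_const V).indicator hset)
      (integrable_of_measurable_of_abs_le hfqm fun x => abs_le_of_mem_Icc (hfqV x)),
      integral_indicator_const _ hset, smul_eq_mul, ← hval] at hle
    have hfW : ∫ x, filtered muhat b q x ∂(M.eta (fun _ => πstar) 0) ≤
        ∫ s, maxFiltered muhat b q s ∂M.ρ := by
      rw [eta_zero, integral_initial_eq _ hfqm fun x => abs_le_of_mem_Icc (hfqV x)]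
      have hin : ∀ s, ∫ a, filtered muhat b q (s, a) ∂πstar.kernel s ≤
          maxFiltered muhat b q s := fun s => by
        have h3 : ∫ a, filtered muhat b q (s, a) ∂πstar.kernel s ≤
            ∫ _, maxFiltered muhat b q s ∂πstar.kernel s :=
          integral_mono (integrable_of_measurable_of_abs_le (hfqm.comp measurable_prodMk_left)
            fun a => abs_le_of_mem_Icc (hfqV _)) (integrable_const _)
            (filtered_le_maxFiltered hV hqV s)
        simpa using h3
      refine integral_mono_of_nonneg (ae_of_all _ fun s => integral_nonneg fun a => (hfqV _).1)
        (integrable_of_measurable_of_abs_le hWm fun s => abs_le_of_mem_Icc (hW s))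
        (ae_of_all _ hin)
    have hprob : (M.eta (fun _ => πstar) 0).real {x | muhat x < b} ≤
        (ε + U / b * epsMu) / (1 - M.γ) := by
      have h3 := measureReal_muhat_lt_le (hU (fun _ => πstar) 0) hmu hmuhat hb
      have h4 := mul_le_mul_of_nonneg_left htv hC
      -- A loss for uniformity: only the coverage term needs the factor `1 / (1 - γ)`.
      have h5 : U / b * epsMu ≤ U / b * epsMu / (1 - M.γ) := by
        rw [le_div_iff₀ hγ1]
        nlinarith [mul_nonneg hC heps]
      rw [add_div]
      linarith
    have h6 := mul_le_mul_of_nonneg_left hprob hV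
    linarith
  have h3 : e (k + 1) = K + M.γ * e k := rfl
  -- Multiplying `e (k + 1) + B` by `1 - γ` leaves `e (k + 1) + U / b * (d + V * epsMu) + γ * e k`.
  -- By `h3` this is at most `2 * e (k + 1)`, which produces the factor `2` in the bound.
  have h4 : e (k + 1) ≤ K / (1 - M.γ) + M.γ ^ (k + 1) * V :=
    accumulatedError_le hγ M.γ_lt_one hK0 _
  have h5 : e (k + 1) + B ≤ 2 * (K / (1 - M.γ) + M.γ ^ (k + 1) * V) / (1 - M.γ) := by
    rw [hBdef, le_div_iff₀ hγ1, add_mul, div_mul_cancel₀ _ hγ1.ne']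
    have h6 : 0 ≤ U / b * res := mul_nonneg hC hres0
    have h7 : K = U / b * (d + V * epsMu) + U / b * res := by rw [hK]; ring
    linarith
  have h6 : 2 * (K / (1 - M.γ) + M.γ ^ (k + 1) * V) / (1 - M.γ) +
      V * ((ε + U / b * epsMu) / (1 - M.γ)) =
      2 * (U / b) * (d + V * epsMu + res) / (1 - M.γ) ^ 2 +
      (2 * M.γ ^ (k + 1) + (ε + U / b * epsMu)) * V / (1 - M.γ) := by
    rw [hK]
    have := hγ1.ne'
    field_simp
    ring
  linarith

end Performance

/-! ### Exponential moments and a Bernstein-type tail bound. -/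

section Concentration

variable {X : Type*} [MeasurableSpace X] {P : Measure X} [IsProbabilityMeasure P]

/-- Integrate `exp (-y) ≤ 1 - y + y ^ 2`, valid for `|y| ≤ 1`, and then use `1 + z ≤ exp z`. The
uncentred second moment is enough. -/
lemma integral_exp_neg_mul_le {Z : X → ℝ} (hZ : Measurable Z) {B lam : ℝ} (hlam : 0 ≤ lam)
    (hB : ∀ᵐ x ∂P, |Z x| ≤ B) (hlB : lam * B ≤ 1) {S : ℝ} (hS : ∫ x, Z x ^ 2 ∂P ≤ S) :
    ∫ x, Real.exp (-(lam * Z x)) ∂P ≤ Real.exp (-(lam * ∫ x, Z x ∂P) + lam ^ 2 * S) := by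
  have hZI : Integrable Z P := Integrable.of_bound hZ.aestronglyMeasurable B hB
  have hZ2 : Integrable (fun x => Z x ^ 2) P := by
    refine Integrable.of_bound (hZ.pow_const 2).aestronglyMeasurable (B ^ 2) ?_
    filter_upwards [hB] with x hx
    rw [Real.norm_eq_abs, abs_pow]
    exact pow_le_pow_left₀ (abs_nonneg _) hx 2
  have h1 : ∫ x, Real.exp (-(lam * Z x)) ∂P ≤
      ∫ x, (1 - lam * Z x + lam ^ 2 * Z x ^ 2) ∂P := by
    refine integral_mono_of_nonneg (ae_of_all _ fun _ => (Real.exp_pos _).le)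
      (((integrable_const _).sub (hZI.const_mul _)).add (hZ2.const_mul _)) ?_
    filter_upwards [hB] with x hx
    have h2 : |-(lam * Z x)| ≤ 1 := by
      rw [abs_neg, abs_mul, abs_of_nonneg hlam]
      exact (mul_le_mul_of_nonneg_left hx hlam).trans hlB
    have h3 := (le_abs_self _).trans (Real.abs_exp_sub_one_sub_id_le h2)
    rw [neg_sq, mul_pow] at h3
    linarith
  have hI : Integrable (fun x => 1 - lam * Z x) P := (integrable_const _).sub (hZI.const_mul _)
  rw [integral_add hI (hZ2.const_mul _), integral_sub (integrable_const _) (hZI.const_mul _),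
    integral_const_mul, integral_const_mul, integral_const, probReal_univ, one_smul] at h1
  have h4 := mul_le_mul_of_nonneg_left hS (sq_nonneg lam)
  have h5 := Real.add_one_le_exp (-(lam * ∫ x, Z x ∂P) + lam ^ 2 * S)
  linarith

/-- A one-sided Bernstein bound for the sum of independent copies of `Z`. -/
lemma measureReal_pi_deviation_le {Z : X → ℝ} (hZ : Measurable Z) {B lam : ℝ} (hlam : 0 ≤ lam)
    (hB : ∀ᵐ x ∂P, |Z x| ≤ B) (hlB : lam * B ≤ 1) {E S : ℝ} (hE : ∫ x, Z x ∂P = E)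
    (hS : ∫ x, Z x ^ 2 ∂P ≤ S) (n : ℕ) (L : ℝ) :
    (Measure.pi fun _ : Fin n => P).real
      {D | L ≤ -(lam * ∑ i, Z (D i)) + n * (lam * E - lam ^ 2 * S)} ≤ Real.exp (-L) := by
  have hexp : Integrable (fun x => Real.exp (-(lam * Z x))) P := by
    refine Integrable.of_bound (hZ.const_mul lam).neg.exp.aestronglyMeasurable (Real.exp 1) ?_
    filter_upwards [hB] with x hx
    rw [Real.norm_of_nonneg (Real.exp_pos _).le]
    refine Real.exp_le_exp.2 ((neg_le_abs _).trans ?_)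
    rw [abs_mul, abs_of_nonneg hlam]
    exact (mul_le_mul_of_nonneg_left hx hlam).trans hlB
  have hprod : ∀ D : Fin n → X, ∏ i, Real.exp (-(lam * Z (D i))) =
      Real.exp (-(lam * ∑ i, Z (D i))) := fun D => by
    rw [← Real.exp_sum, Finset.sum_neg_distrib, Finset.mul_sum]
  have hI : Integrable (fun D : Fin n → X => ∏ i, Real.exp (-(lam * Z (D i))))
      (Measure.pi fun _ : Fin n => P) :=
    Integrable.fintype_prod (f := fun _ x => Real.exp (-(lam * Z x))) fun _ => hexp
  have h1 := mul_meas_ge_le_integral_of_nonneg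
    (ae_of_all _ fun D => Finset.prod_nonneg fun i _ => (Real.exp_pos _).le) hI
    (Real.exp (L - n * (lam * E - lam ^ 2 * S)))
  rw [integral_fintype_prod_eq_pow (fun x => Real.exp (-(lam * Z x))), Fintype.card_fin] at h1
  have h2 := integral_exp_neg_mul_le hZ hlam hB hlB hS
  rw [hE] at h2
  have h3 := pow_le_pow_left₀ (integral_nonneg fun x => (Real.exp_pos _).le) h2 n
  rw [← Real.exp_nat_mul] at h3
  have hset : {D : Fin n → X | L ≤ -(lam * ∑ i, Z (D i)) + n * (lam * E - lam ^ 2 * S)} =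
      {D | Real.exp (L - n * (lam * E - lam ^ 2 * S)) ≤ ∏ i, Real.exp (-(lam * Z (D i)))} := by
    ext D
    simp only [Set.mem_ofPred_eq, hprod, Real.exp_le_exp]
    constructor <;> intro h <;> linarith
  rw [hset]
  refine le_of_mul_le_mul_left ((h1.trans h3).trans (le_of_eq ?_))
    (Real.exp_pos (L - n * (lam * E - lam ^ 2 * S)))
  rw [← Real.exp_add]
  congr 1
  ring

end Concentration

/-! ### The self-bounding inequality behind the fast rate. -/

section FastRate

/-- The inverse temperature used in the exponential moment bound. -/
def temperature (V a x e : ℝ) : ℝ := a / (4 * V ^ 2 * (x + e + a))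

/-- The fast rate: a self-bounding inequality for the regression error. -/
lemma le_add_of_temperature_bound {V a x e N l : ℝ} (hV : 0 < V) (ha : 0 < a) (hx : 0 ≤ x)
    (he : 0 ≤ e) (hN : 0 < N) (hl : a ^ 2 = V ^ 2 * l / N)
    (h : N * (temperature V a x e * (x ^ 2 - e ^ 2) -
      temperature V a x e ^ 2 * (32 * V ^ 2 * (x ^ 2 + e ^ 2))) ≤ 3 * l) :
    x ≤ e + 32 * a := by
  -- With `s = x + e + a`, clearing the common factor gives `(x ^ 2 - e ^ 2) * s - 8 * a * (x ^ 2 +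
  -- e ^ 2) ≤ 12 * a * s ^ 2`. If `x > e + 32 * a`, the left side is at least `(32 - 8) * a * (x +
  -- e) * s`, and `2 * (x + e) > s` gives a contradiction.
  by_contra! hcon
  have hs : 0 < x + e + a := by positivity
  have hl' : l = a ^ 2 * N / V ^ 2 := by rw [hl]; field_simp
  have h1 : N * (temperature V a x e * (x ^ 2 - e ^ 2) -
      temperature V a x e ^ 2 * (32 * V ^ 2 * (x ^ 2 + e ^ 2))) =
      N * a / (4 * V ^ 2 * (x + e + a) ^ 2) *
        ((x ^ 2 - e ^ 2) * (x + e + a) - 8 * a * (x ^ 2 + e ^ 2)) := by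
    unfold temperature
    field_simp
    ring
  have h2 : 3 * l = N * a / (4 * V ^ 2 * (x + e + a) ^ 2) * (12 * a * (x + e + a) ^ 2) := by
    rw [hl']
    field_simp
    ring
  rw [h1, h2] at h
  have h3 := le_of_mul_le_mul_left h (by positivity)
  have h4 : 32 * a * (x + e) ≤ x ^ 2 - e ^ 2 := by
    nlinarith [mul_le_mul_of_nonneg_right hcon.le (add_nonneg hx he)]
  have h5 := mul_le_mul_of_nonneg_right h4 hs.le
  have h6 : 8 * a * (x ^ 2 + e ^ 2) ≤ 8 * a * ((x + e) * (x + e + a)) :=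
    mul_le_mul_of_nonneg_left (by nlinarith [mul_nonneg hx he, mul_nonneg ha.le (add_nonneg hx he)])
      (by positivity)
  have h7 : a < x + e := by linarith
  nlinarith [mul_pos (mul_pos ha hs) (sub_pos.2 h7)]

end FastRate

/-! ### Excess loss of one regressor over another. -/

section ExcessLoss

variable {S A : Type*}

/-- The difference of the losses of `u` and `v` on one sample, when the regression targets are
computed from `f`. -/
def excessLoss (γ : ℝ) (muhat : S × A → ℝ) (b : ℝ) (f u v : S × A → ℝ) (ω : Sample S A) : ℝ :=
  (u ω.1 - ω.2.1 - γ * maxFiltered muhat b f ω.2.2) ^ 2 -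
    (v ω.1 - ω.2.1 - γ * maxFiltered muhat b f ω.2.2) ^ 2

lemma sum_excessLoss_nonpos {n : ℕ} (hn : 0 < n) {γ b : ℝ} {muhat f u v : S × A → ℝ}
    {D : Fin n → Sample S A} (h : empLoss γ muhat b D u f ≤ empLoss γ muhat b D v f) :
    ∑ i, excessLoss γ muhat b f u v (D i) ≤ 0 := by
  unfold excessLoss
  rw [Finset.sum_sub_distrib]
  unfold empLoss at h
  have := (div_le_div_iff_of_pos_right (Nat.cast_pos.2 hn)).1 h
  linarith

end ExcessLoss

/-! ### Moments of the excess loss and the regression error. -/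

section Regression

variable {S A : Type*} [MeasurableSpace S] [MeasurableSpace A]

/-- The distance of `u` from the regression function. -/
def regError (M : MDP S A) (m : Measure (S × A)) (muhat : S × A → ℝ) (b : ℝ)
    (f u : S × A → ℝ) : ℝ :=
  l2norm m fun x => u x - M.bellman muhat b f x

variable {M : MDP S A} {m : Measure (S × A)}
  {muhat f u v : S × A → ℝ} {b V : ℝ}

lemma regError_nonneg : 0 ≤ regError M m muhat b f u := Real.sqrt_nonneg _

lemma regError_sq : regError M m muhat b f u ^ 2 = ∫ x, (u x - M.bellman muhat b f x) ^ 2 ∂m :=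
  Real.sq_sqrt (integral_nonneg fun _ => sq_nonneg _)

lemma abs_sub_bellman_le (hR : ∀ x, ∀ᵐ r ∂(M.R x), |r| ≤ V) (hV : 0 ≤ V)
    (hfV : ∀ x, 0 ≤ f x ∧ f x ≤ V) (huV : ∀ x, 0 ≤ u x ∧ u x ≤ V) (x : S × A) :
    |u x - M.bellman muhat b f x| ≤ 3 * V := by
  have h1 := abs_le.1 (abs_bellman_le (muhat := muhat) (b := b) hR hV hfV x)
  exact abs_le.2 ⟨by linarith [(huV x).1], by linarith [(huV x).2]⟩

lemma ae_abs_reward_le (hR : ∀ x, ∀ᵐ r ∂(M.R x), |r| ≤ V) :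
    ∀ᵐ ω ∂M.sampleLaw m, |ω.2.1| ≤ V := by
  refine Measure.ae_compProd_of_ae_ae (measurableSet_le (by fun_prop) measurable_const)
    (ae_of_all _ fun x => ?_)
  rw [Kernel.prod_apply]
  exact Measure.quasiMeasurePreserving_fst.ae (hR x)

/-- The difference of squares factors through `u - v`. Keeping this factor, instead of bounding it
by `V`, is what later ties the second moment to the regression errors. -/
lemma ae_abs_excessLoss_le (hR : ∀ x, ∀ᵐ r ∂(M.R x), |r| ≤ V) (hV : 0 ≤ V)
    (hfV : ∀ x, 0 ≤ f x ∧ f x ≤ V) (huV : ∀ x, 0 ≤ u x ∧ u x ≤ V)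
    (hvV : ∀ x, 0 ≤ v x ∧ v x ≤ V) :
    ∀ᵐ ω ∂M.sampleLaw m,
      |excessLoss M.γ muhat b f u v ω| ≤ 4 * V * |u ω.1 - v ω.1| := by
  filter_upwards [ae_abs_reward_le hR] with ω hω
  have h1 := maxFiltered_mem_Icc (muhat := muhat) (b := b) hV hfV ω.2.2
  have h2 : M.γ * maxFiltered muhat b f ω.2.2 ≤ V :=
    (mul_le_mul M.γ_lt_one.le h1.2 h1.1 zero_le_one).trans (one_mul V).le
  have h3 : 0 ≤ M.γ * maxFiltered muhat b f ω.2.2 := mul_nonneg M.γ_nonneg h1.1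
  have h4 := abs_le.1 hω
  have h5 := huV ω.1
  have h6 := hvV ω.1
  have h7 : excessLoss M.γ muhat b f u v ω = (u ω.1 + v ω.1 - 2 * ω.2.1 -
      2 * (M.γ * maxFiltered muhat b f ω.2.2)) * (u ω.1 - v ω.1) := by
    unfold excessLoss; ring
  rw [h7, abs_mul]
  refine mul_le_mul_of_nonneg_right (abs_le.2 ⟨?_, ?_⟩) (abs_nonneg _) <;> linarith

lemma ae_abs_excessLoss_le_const (hR : ∀ x, ∀ᵐ r ∂(M.R x), |r| ≤ V) (hV : 0 ≤ V)
    (hfV : ∀ x, 0 ≤ f x ∧ f x ≤ V) (huV : ∀ x, 0 ≤ u x ∧ u x ≤ V)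
    (hvV : ∀ x, 0 ≤ v x ∧ v x ≤ V) :
    ∀ᵐ ω ∂M.sampleLaw m, |excessLoss M.γ muhat b f u v ω| ≤ 4 * V ^ 2 := by
  filter_upwards [ae_abs_excessLoss_le (m := m) (muhat := muhat) (b := b) hR hV hfV huV hvV]
    with ω hω
  have h1 := mul_le_mul_of_nonneg_left (abs_sub_mem_Icc huV hvV ω.1).2
    (show 0 ≤ 4 * V by linarith)
  linarith

/-- The statistic whose upper tail controls the regression error of `u` relative to `v`. -/
def deviation (M : MDP S A) (m : Measure (S × A)) (V a : ℝ) (muhat : S × A → ℝ) (b : ℝ)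
    (f u v : S × A → ℝ) {n : ℕ} (D : Fin n → Sample S A) : ℝ :=
  -(temperature V a (regError M m muhat b f u) (regError M m muhat b f v) *
      ∑ i, excessLoss M.γ muhat b f u v (D i)) +
    n * (temperature V a (regError M m muhat b f u) (regError M m muhat b f v) *
        (regError M m muhat b f u ^ 2 - regError M m muhat b f v ^ 2) -
      temperature V a (regError M m muhat b f u) (regError M m muhat b f v) ^ 2 *
        (32 * V ^ 2 * (regError M m muhat b f u ^ 2 + regError M m muhat b f v ^ 2)))

/-- An empirical minimizer `u` has nonpositive total excess loss over `v`, so the sum can be dropped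
from the deviation, leaving the hypothesis of the fast rate. -/
lemma regError_le_of_deviation_lt {n : ℕ} (hn : 0 < n) {a l L : ℝ} (hV : 0 < V) (ha : 0 < a)
    (hl : a ^ 2 = V ^ 2 * l / n) (hL : L ≤ 3 * l) {D : Fin n → Sample S A}
    (hD : deviation M m V a muhat b f u v D < L)
    (h : empLoss M.γ muhat b D u f ≤ empLoss M.γ muhat b D v f) :
    regError M m muhat b f u ≤ regError M m muhat b f v + 32 * a := by
  have hx : 0 ≤ regError M m muhat b f u := regError_nonneg
  have he : 0 ≤ regError M m muhat b f v := regError_nonneg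
  refine le_add_of_temperature_bound hV ha hx he (Nat.cast_pos.2 hn) hl ?_
  have h1 : 0 ≤ temperature V a (regError M m muhat b f u) (regError M m muhat b f v) := by
    unfold temperature; positivity
  have h2 := mul_nonpos_of_nonneg_of_nonpos h1 (sum_excessLoss_nonpos hn h)
  unfold deviation at hD
  linarith

variable [IsProbabilityMeasure m]

instance : IsProbabilityMeasure (M.sampleLaw m) := by
  unfold MDP.sampleLaw; infer_instance

variable [Countable A]

lemma measurable_excessLoss {γ : ℝ} (hmuhat : Measurable muhat) (hf : Measurable f)
    (hu : Measurable u) (hv : Measurable v) : Measurable (excessLoss γ muhat b f u v) := by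
  have := measurable_maxFiltered (b := b) hmuhat hf
  unfold excessLoss
  fun_prop

lemma integral_target (hR : ∀ x, ∀ᵐ r ∂(M.R x), |r| ≤ V) (hV : 0 ≤ V) (hmuhat : Measurable muhat)
    (hf : Measurable f) (hfV : ∀ x, 0 ≤ f x ∧ f x ≤ V) (x : S × A) :
    Integrable (fun y : ℝ × S => y.1 + M.γ * maxFiltered muhat b f y.2) ((M.R ×ₖ M.P) x) ∧
    ∫ y, (y.1 + M.γ * maxFiltered muhat b f y.2) ∂((M.R ×ₖ M.P) x) = M.bellman muhat b f x := by
  rw [Kernel.prod_apply]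
  have h1 : Integrable (fun r : ℝ => r) (M.R x) :=
    Integrable.of_bound measurable_id.aestronglyMeasurable V (hR x)
  have h2 : Integrable (fun s => M.γ * maxFiltered muhat b f s) (M.P x) :=
    (integrable_of_measurable_of_abs_le (measurable_maxFiltered hmuhat hf) fun s =>
      abs_le_of_mem_Icc (maxFiltered_mem_Icc hV hfV s)).const_mul _
  refine ⟨(h1.comp_fst (M.P x)).add (h2.comp_snd (M.R x)), ?_⟩
  rw [integral_add (h1.comp_fst (M.P x)) (h2.comp_snd (M.R x)), integral_fun_fst (fun r : ℝ => r),
    integral_fun_snd (fun s => M.γ * maxFiltered muhat b f s), integral_const_mul]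
  simp [MDP.bellman, MDP.meanReward]

lemma integrable_sub_bellman_sq (hR : ∀ x, ∀ᵐ r ∂(M.R x), |r| ≤ V) (hV : 0 ≤ V)
    (hmuhat : Measurable muhat) (hf : Measurable f) (hfV : ∀ x, 0 ≤ f x ∧ f x ≤ V)
    (hu : Measurable u) (huV : ∀ x, 0 ≤ u x ∧ u x ≤ V) :
    Integrable (fun x => (u x - M.bellman muhat b f x) ^ 2) m := by
  refine integrable_of_measurable_of_abs_le (C := (3 * V) ^ 2)
    ((hu.sub (measurable_bellman hmuhat hf)).pow_const 2) fun x => ?_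
  rw [abs_pow]
  exact pow_le_pow_left₀ (abs_nonneg _) (abs_sub_bellman_le hR hV hfV huV x) 2

/-- The squares of the regression target cancel, so the excess loss is affine in the target, whose
conditional mean is the Bellman image of `f`. -/
lemma integral_excessLoss (hR : ∀ x, ∀ᵐ r ∂(M.R x), |r| ≤ V) (hV : 0 ≤ V)
    (hmuhat : Measurable muhat) (hf : Measurable f) (hfV : ∀ x, 0 ≤ f x ∧ f x ≤ V)
    (hu : Measurable u) (huV : ∀ x, 0 ≤ u x ∧ u x ≤ V) (hv : Measurable v)
    (hvV : ∀ x, 0 ≤ v x ∧ v x ≤ V) :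
    ∫ ω, excessLoss M.γ muhat b f u v ω ∂M.sampleLaw m =
      regError M m muhat b f u ^ 2 - regError M m muhat b f v ^ 2 := by
  have hI : Integrable (excessLoss M.γ muhat b f u v) (m ⊗ₘ (M.R ×ₖ M.P)) :=
    Integrable.of_bound (measurable_excessLoss hmuhat hf hu hv).aestronglyMeasurable _
      (ae_abs_excessLoss_le_const (m := m) hR hV hfV huV hvV)
  rw [regError_sq, regError_sq,
    ← integral_sub (integrable_sub_bellman_sq hR hV hmuhat hf hfV hu huV)
      (integrable_sub_bellman_sq hR hV hmuhat hf hfV hv hvV), MDP.sampleLaw,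
    Measure.integral_compProd hI]
  refine integral_congr_ae (ae_of_all _ fun x => ?_)
  obtain ⟨h1, h2⟩ := integral_target (b := b) hR hV hmuhat hf hfV x
  have h3 : ∀ y : ℝ × S, excessLoss M.γ muhat b f u v (x, y) =
      (u x ^ 2 - v x ^ 2) - 2 * (u x - v x) * (y.1 + M.γ * maxFiltered muhat b f y.2) := by
    intro y; unfold excessLoss; ring
  simp only [h3]
  rw [integral_sub (integrable_const _) (h1.const_mul _), integral_const_mul, h2]
  simp only [integral_const, probReal_univ, one_smul]
  ring

lemma integral_excessLoss_sq_le (hR : ∀ x, ∀ᵐ r ∂(M.R x), |r| ≤ V) (hV : 0 ≤ V)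
    (hmuhat : Measurable muhat) (hf : Measurable f) (hfV : ∀ x, 0 ≤ f x ∧ f x ≤ V)
    (hu : Measurable u) (huV : ∀ x, 0 ≤ u x ∧ u x ≤ V) (hv : Measurable v)
    (hvV : ∀ x, 0 ≤ v x ∧ v x ≤ V) :
    ∫ ω, excessLoss M.γ muhat b f u v ω ^ 2 ∂M.sampleLaw m ≤
      32 * V ^ 2 * (regError M m muhat b f u ^ 2 + regError M m muhat b f v ^ 2) := by
  have hIu := integrable_sub_bellman_sq (m := m) (b := b) hR hV hmuhat hf hfV hu huV
  have hIv := integrable_sub_bellman_sq (m := m) (b := b) hR hV hmuhat hf hfV hv hvV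
  have hI := (hIu.add hIv).const_mul (32 * V ^ 2)
  rw [regError_sq, regError_sq, ← integral_add hIu hIv, ← integral_const_mul]
  have hfst : (m ⊗ₘ (M.R ×ₖ M.P)).map Prod.fst = m := Measure.fst_compProd m (M.R ×ₖ M.P)
  have hint : ∀ {h : S × A → ℝ}, Integrable h m →
      Integrable (fun ω => h ω.1) (M.sampleLaw m) ∧
        ∫ ω, h ω.1 ∂M.sampleLaw m = ∫ x, h x ∂m := by
    intro h hh
    rw [← hfst] at hh
    refine ⟨hh.comp_measurable measurable_fst, ?_⟩
    conv_rhs => rw [← hfst]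
    exact (integral_map measurable_fst.aemeasurable hh.aestronglyMeasurable).symm
  simp only [Pi.add_apply] at hI
  rw [← (hint hI).2]
  refine integral_mono_of_nonneg (ae_of_all _ fun _ => sq_nonneg _) (hint hI).1 ?_
  filter_upwards [ae_abs_excessLoss_le (m := m) (muhat := muhat) (b := b) hR hV hfV huV hvV]
    with ω hω
  have h1 := pow_le_pow_left₀ (abs_nonneg _) hω 2
  rw [sq_abs, mul_pow, sq_abs] at h1
  refine h1.trans ?_
  -- The constant `32` is `4 ^ 2` from the pointwise bound times this `2`.
  have h2 : (u ω.1 - v ω.1) ^ 2 ≤ 2 * ((u ω.1 - M.bellman muhat b f ω.1) ^ 2 +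
      (v ω.1 - M.bellman muhat b f ω.1) ^ 2) := by
    nlinarith [sq_nonneg ((u ω.1 - M.bellman muhat b f ω.1) +
      (v ω.1 - M.bellman muhat b f ω.1))]
  nlinarith [mul_le_mul_of_nonneg_left h2 (sq_nonneg V)]

lemma measureReal_deviation_le (hR : ∀ x, ∀ᵐ r ∂(M.R x), |r| ≤ V) (hV : 0 < V)
    (hmuhat : Measurable muhat) (hf : Measurable f) (hfV : ∀ x, 0 ≤ f x ∧ f x ≤ V)
    (hu : Measurable u) (huV : ∀ x, 0 ≤ u x ∧ u x ≤ V) (hv : Measurable v)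
    (hvV : ∀ x, 0 ≤ v x ∧ v x ≤ V) {a : ℝ} (ha : 0 < a) (n : ℕ) (L : ℝ) :
    (M.datasetLaw m n).real {D | L ≤ deviation M m V a muhat b f u v D} ≤ Real.exp (-L) := by
  have hx : 0 ≤ regError M m muhat b f u := regError_nonneg
  have he : 0 ≤ regError M m muhat b f v := regError_nonneg
  refine measureReal_pi_deviation_le (measurable_excessLoss hmuhat hf hu hv) ?_
    (ae_abs_excessLoss_le_const hR hV.le hfV huV hvV) ?_
    (integral_excessLoss hR hV.le hmuhat hf hfV hu huV hv hvV)
    (integral_excessLoss_sq_le hR hV.le hmuhat hf hfV hu huV hv hvV) n L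
  · unfold temperature; positivity
  -- The factor `4 * V ^ 2` in the temperature is exactly the almost sure bound on the excess loss.
  · unfold temperature
    rw [div_mul_eq_mul_div, div_le_one (by positivity)]
    nlinarith [mul_nonneg (sq_nonneg V) (add_nonneg hx he)]

end Regression

/-! ### Measurability jointly in the density estimate and the data. -/

section JointMeasurability

variable {S A Θ : Type*} [MeasurableSpace S] [MeasurableSpace A] [MeasurableSpace Θ] [Countable A]
  {M : MDP S A} {m : Measure (S × A)} {muhat : Θ → S × A → ℝ} {f u v : S × A → ℝ} {b : ℝ}

lemma measurable_maxFiltered_uncurry (hmuhat : Measurable (Function.uncurry muhat))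
    (hf : Measurable f) : Measurable fun p : Θ × S => maxFiltered (muhat p.1) b f p.2 := by
  unfold maxFiltered
  refine Measurable.iSup fun a => ?_
  have hpair : Measurable fun p : Θ × S => (p.2, a) := measurable_snd.prodMk measurable_const
  have hset : MeasurableSet {p : Θ × S | b ≤ muhat p.1 (p.2, a)} :=
    measurableSet_le measurable_const (hmuhat.comp (measurable_fst.prodMk hpair))
  exact (hf.comp hpair).indicator hset

lemma measurable_bellman_uncurry (hmuhat : Measurable (Function.uncurry muhat))
    (hf : Measurable f) : Measurable fun p : Θ × (S × A) => M.bellman (muhat p.1) b f p.2 := by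
  unfold MDP.bellman
  refine ((measurable_meanReward M).comp measurable_snd).add (Measurable.const_mul ?_ _)
  have h : Measurable fun p : (Θ × (S × A)) × S => maxFiltered (muhat p.1.1) b f p.2 :=
    (measurable_maxFiltered_uncurry hmuhat hf).comp
      ((measurable_fst.comp measurable_fst).prodMk measurable_snd)
  exact (h.stronglyMeasurable.integral_kernel_prod_right'
    (κ := M.P.comap Prod.snd measurable_snd)).measurable

lemma measurable_regError [SFinite m] (hmuhat : Measurable (Function.uncurry muhat))
    (hf : Measurable f) (hu : Measurable u) :
    Measurable fun θ => regError M m (muhat θ) b f u := by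
  unfold regError l2norm
  refine Real.continuous_sqrt.measurable.comp ?_
  have h : Measurable (Function.uncurry fun (θ : Θ) (x : S × A) =>
      (u x - M.bellman (muhat θ) b f x) ^ 2) :=
    ((hu.comp measurable_snd).sub (measurable_bellman_uncurry hmuhat hf)).pow_const 2
  exact h.stronglyMeasurable.integral_prod_right.measurable

lemma measurable_deviation [SFinite m] (hmuhat : Measurable (Function.uncurry muhat))
    (hf : Measurable f) (hu : Measurable u) (hv : Measurable v) (V a : ℝ) (n : ℕ) :
    Measurable fun ω : Θ × (Fin n → Sample S A) =>
      deviation M m V a (muhat ω.1) b f u v ω.2 := by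
  have hx : Measurable fun ω : Θ × (Fin n → Sample S A) => regError M m (muhat ω.1) b f u :=
    (measurable_regError hmuhat hf hu).comp measurable_fst
  have he : Measurable fun ω : Θ × (Fin n → Sample S A) => regError M m (muhat ω.1) b f v :=
    (measurable_regError hmuhat hf hv).comp measurable_fst
  have hZ : ∀ i : Fin n, Measurable fun ω : Θ × (Fin n → Sample S A) =>
      excessLoss M.γ (muhat ω.1) b f u v (ω.2 i) := by
    intro i
    have hW : Measurable fun ω : Θ × (Fin n → Sample S A) =>
        maxFiltered (muhat ω.1) b f (ω.2 i).2.2 :=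
      (measurable_maxFiltered_uncurry hmuhat hf).comp (f := fun ω : Θ × (Fin n → Sample S A) =>
        (ω.1, (ω.2 i).2.2)) (by fun_prop)
    unfold excessLoss
    fun_prop
  unfold deviation temperature
  have hsum : Measurable fun ω : Θ × (Fin n → Sample S A) =>
      ∑ i, excessLoss M.γ (muhat ω.1) b f u v (ω.2 i) :=
    Finset.measurable_fun_sum _ fun i _ => hZ i
  fun_prop

end JointMeasurability

/-! ### Union bound and Fubini. -/

section HighProbability

variable {S A Θ : Type*} [MeasurableSpace S] [MeasurableSpace A] [MeasurableSpace Θ] [Countable A]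
  {M : MDP S A} {m : Measure (S × A)} [IsProbabilityMeasure m] {b V : ℝ}

instance (n : ℕ) : IsProbabilityMeasure (M.datasetLaw m n) := by
  unfold MDP.datasetLaw; infer_instance

/-- Uniform control of the deviations over a finite class. -/
lemma ofReal_le_measure_forall_deviation_lt (hR : ∀ x, ∀ᵐ r ∂(M.R x), |r| ≤ V) (hV : 0 < V)
    {muhat : S × A → ℝ} (hmuhat : Measurable muhat) {F : Finset (S × A → ℝ)} (hF : F.Nonempty)
    (hFV : ∀ f ∈ F, Measurable f ∧ ∀ x, 0 ≤ f x ∧ f x ≤ V) {a δ : ℝ} (ha : 0 < a) (hδ : 0 < δ)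
    (n : ℕ) :
    ENNReal.ofReal (1 - δ) ≤ M.datasetLaw m n {D | ∀ f ∈ F, ∀ u ∈ F, ∀ v ∈ F,
      deviation M m V a muhat b f u v D < Real.log (F.card ^ 3 / δ)} := by
  set L := Real.log (F.card ^ 3 / δ) with hL
  have hN : (0 : ℝ) < F.card := Nat.cast_pos.2 hF.card_pos
  -- The iterates depend on the data, so all choices of the target function, the minimizer and the
  -- comparator are covered at once: hence the cube of the cardinality.
  set bad : (S × A → ℝ) × (S × A → ℝ) × (S × A → ℝ) → Set (Fin n → Sample S A) := fun p =>
    {D | L ≤ deviation M m V a muhat b p.1 p.2.1 p.2.2 D} with hbad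
  set T := F ×ˢ F ×ˢ F with hT
  have hcompl : (⋃ p ∈ T, bad p)ᶜ ⊆ {D | ∀ f ∈ F, ∀ u ∈ F, ∀ v ∈ F,
      deviation M m V a muhat b f u v D < L} := by
    intro D hD f hf u hu v hv
    by_contra hlt
    refine hD (Set.mem_iUnion₂.2 ⟨(f, u, v), ?_, not_lt.1 hlt⟩)
    simp only [hT, Finset.mem_product]
    exact ⟨hf, hu, hv⟩
  have hone : ∀ p ∈ T, M.datasetLaw m n (bad p) ≤ ENNReal.ofReal (δ / F.card ^ 3) := by
    intro p hp
    simp only [hT, Finset.mem_product] at hp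
    obtain ⟨h1, h2, h3⟩ := hp
    have h := measureReal_deviation_le (m := m) (b := b) hR hV hmuhat (hFV _ h1).1 (hFV _ h1).2
      (hFV _ h2).1 (hFV _ h2).2 (hFV _ h3).1 (hFV _ h3).2 ha n L
    rw [hL, Real.exp_neg, Real.exp_log (by positivity), inv_div] at h
    rw [← ofReal_measureReal]
    exact ENNReal.ofReal_le_ofReal h
  have hunion : M.datasetLaw m n (⋃ p ∈ T, bad p) ≤ ENNReal.ofReal δ := by
    refine (measure_biUnion_finset_le T bad).trans ((Finset.sum_le_sum hone).trans (le_of_eq ?_))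
    rw [Finset.sum_const, nsmul_eq_mul, ← ENNReal.ofReal_natCast,
      ← ENNReal.ofReal_mul (Nat.cast_nonneg _)]
    congr 1
    rw [hT, Finset.card_product, Finset.card_product]
    push_cast
    field_simp
  have hadd : (1 : ENNReal) ≤ M.datasetLaw m n (⋃ p ∈ T, bad p) +
      M.datasetLaw m n (⋃ p ∈ T, bad p)ᶜ := by
    rw [← measure_univ (μ := M.datasetLaw m n), ← Set.union_compl_self (⋃ p ∈ T, bad p)]
    exact measure_union_le _ _
  rw [ENNReal.ofReal_sub _ hδ.le, ENNReal.ofReal_one]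
  exact tsub_le_iff_left.2 (hadd.trans (add_le_add hunion (measure_mono hcompl)))

/-- Combining an event for the density estimate with the deviation event for the dataset. -/
lemma exists_measurableSet_deviation_lt (hR : ∀ x, ∀ᵐ r ∂(M.R x), |r| ≤ V) (hV : 0 < V)
    {κ : Measure Θ} [IsProbabilityMeasure κ] {muhat : Θ → S × A → ℝ}
    (hmuhat : Measurable (Function.uncurry muhat)) {F : Finset (S × A → ℝ)} (hF : F.Nonempty)
    (hFV : ∀ f ∈ F, Measurable f ∧ ∀ x, 0 ≤ f x ∧ f x ≤ V) {a δ : ℝ} (ha : 0 < a) (hδ : 0 < δ)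
    (hδ1 : δ < 1) (n : ℕ) {E E' : Θ → Prop} (hE : HoldsWithProbGE κ (1 - δ) E)
    (hE' : ∀ᵐ θ ∂κ, E' θ) :
    HoldsWithProbGE (κ.prod (M.datasetLaw m n)) (1 - 2 * δ) fun ω =>
      E ω.1 ∧ E' ω.1 ∧ ∀ f ∈ F, ∀ u ∈ F, ∀ v ∈ F,
        deviation M m V a (muhat ω.1) b f u v ω.2 < Real.log (F.card ^ 3 / δ) := by
  obtain ⟨G, hG, hGp, hGE⟩ := hE
  obtain ⟨N, hN, hNm, hN0⟩ := exists_measurable_superset_of_null (ae_iff.1 hE')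
  have hdev : MeasurableSet {ω : Θ × (Fin n → Sample S A) | ∀ f ∈ F, ∀ u ∈ F, ∀ v ∈ F,
      deviation M m V a (muhat ω.1) b f u v ω.2 < Real.log (F.card ^ 3 / δ)} := by
    simp only [Set.ofPred_forall]
    exact F.measurableSet_biInter fun f hf => F.measurableSet_biInter fun u hu =>
      F.measurableSet_biInter fun v hv => measurableSet_lt
        (measurable_deviation hmuhat (hFV f hf).1 (hFV u hu).1 (hFV v hv).1 V a n)
        measurable_const
  set H := {ω : Θ × (Fin n → Sample S A) | ∀ f ∈ F, ∀ u ∈ F, ∀ v ∈ F,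
      deviation M m V a (muhat ω.1) b f u v ω.2 < Real.log (F.card ^ 3 / δ)} with hH
  have hGN : MeasurableSet (G \ N) := hG.diff hNm
  refine ⟨Prod.fst ⁻¹' (G \ N) ∩ H, (measurable_fst hGN).inter hdev, ?_, ?_⟩
  · rw [Measure.prod_apply ((measurable_fst hGN).inter hdev)]
    have h1 : ∫⁻ _ in G \ N, ENNReal.ofReal (1 - δ) ∂κ ≤
        ∫⁻ θ, M.datasetLaw m n (Prod.mk θ ⁻¹' (Prod.fst ⁻¹' (G \ N) ∩ H)) ∂κ := by
      rw [← lintegral_indicator hGN]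
      refine lintegral_mono fun θ => ?_
      by_cases hθ : θ ∈ G \ N
      · rw [Set.indicator_of_mem hθ]
        refine (ofReal_le_measure_forall_deviation_lt (m := m) (b := b) hR hV
          (hmuhat.comp measurable_prodMk_left : Measurable (muhat θ)) hF hFV ha hδ n).trans
          (measure_mono fun D hD => ⟨hθ, hD⟩)
      · rw [Set.indicator_of_notMem hθ]
        exact zero_le
    refine le_trans ?_ h1
    rw [setLIntegral_const, measure_sdiff_null hN0]
    -- Each slice and the event for the estimate have probability at least `1 - δ`, and `(1 - δ) ^ 2
    -- ≥ 1 - 2 * δ`.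
    refine le_trans ?_ (mul_le_mul_right hGp _)
    rw [← ENNReal.ofReal_mul (by linarith)]
    exact ENNReal.ofReal_le_ofReal (by nlinarith [sq_nonneg δ])
  · rintro ω ⟨⟨h1, h2⟩, h3⟩
    refine ⟨hGE _ h1, ?_, h3⟩
    by_contra h
    exact h2 (hN h)

end HighProbability

/-! ### Final ingredients and the main theorem. -/

section Assembly

variable {S A : Type*} [MeasurableSpace S] [MeasurableSpace A] {M : MDP S A}

/-- The share of the time step `0` in the discounted state-action distribution. -/
lemma eta_zero_real_le (π : Policy S A) {B : Set (S × A)} (hB : MeasurableSet B) {ε : ℝ}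
    (hε : 0 ≤ ε) (h : M.etaDisc π B ≤ ENNReal.ofReal ε) :
    (M.eta (fun _ => π) 0).real B ≤ ε / (1 - M.γ) := by
  have hγ : 0 < 1 - M.γ := by linarith [M.γ_lt_one]
  have h1 : ENNReal.ofReal (1 - M.γ) * M.eta (fun _ => π) 0 B ≤ M.etaDisc π B := by
    unfold MDP.etaDisc
    rw [Measure.sum_apply _ hB]
    refine le_trans (le_of_eq ?_) (ENNReal.le_tsum 0)
    simp
  have h2 := ENNReal.toReal_mono ENNReal.ofReal_ne_top (h1.trans h)
  rw [ENNReal.toReal_mul, ENNReal.toReal_ofReal hγ.le, ENNReal.toReal_ofReal hε] at h2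
  rw [le_div_iff₀ hγ, mul_comm]
  exact h2

lemma errorBound_nonneg_of_Vmax_eq_zero {c γ U b δ epsF epsMu epsZeta res : ℝ} {N n t : ℕ}
    (hC : 0 ≤ U / b) (hres : 0 ≤ res) (hc : 0 ≤ c) :
    0 ≤ errorBound c γ 0 U b δ epsF epsMu epsZeta res N n t := by
  unfold errorBound
  rw [zero_mul, mul_zero, zero_div, add_zero, add_zero]
  positivity

lemma optValue_le_of_isOptimal {π : Policy S A} (h : M.IsOptimal π) : M.optValue ≤ M.value π :=
  have : Nonempty (Policy S A) := ⟨π⟩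
  ciSup_le h

end Assembly

end

end MBSQI

theorem corollary3 :
    -- the constant hidden in the `O(·)` is absolute
    ∃ c : ℝ, 0 < c ∧
    ∀ (S A Θ : Type*) [MeasurableSpace S] [MeasurableSpace A] [Countable A]
      [MeasurableSingletonClass A] [MeasurableSpace Θ]
      -- reference measure on states; densities on pairs are taken with respect to `lam × count`
      (lam : Measure S) [SigmaFinite lam]
      (M : MBSQI.MDP S A) (Vmax U b δ ε epsMu epsF : ℝ)
      (mu : S × A → ℝ) (F : Finset (S × A → ℝ))
      -- the law of the randomness of the density estimate, and the density estimate
      (κ : Measure Θ) [IsProbabilityMeasure κ] (muhat : Θ → S × A → ℝ)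
      (n t : ℕ) (πstar : MBSQI.Policy S A),
      0 < n → 1 ≤ t → 0 < b → 0 < δ → δ < 1 → 0 ≤ ε →
      -- values and rewards are bounded
      (∀ (π : MBSQI.Policy S A) (x : S × A), 0 ≤ M.Q π x ∧ M.Q π x ≤ Vmax) →
      (∀ x : S × A, ∀ᵐ r ∂(M.R x), |r| ≤ Vmax) →
      -- `F` is a finite class of functions with values in `[0, Vmax]`
      (∀ f ∈ F, Measurable f ∧ ∀ x, 0 ≤ f x ∧ f x ≤ Vmax) →
      -- the behavior density and the density estimate
      MBSQI.IsProbDensity (lam.prod Measure.count) mu →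
      Measurable (Function.uncurry muhat) →
      (∀ θ, MBSQI.IsProbDensity (lam.prod Measure.count) (muhat θ)) →
      -- bounded densities, for every non-stationary policy
      (∀ (π : ℕ → MBSQI.Policy S A) (h : ℕ),
        MBSQI.HasDensityLE (lam.prod Measure.count) U (M.eta π h)) →
      -- density estimation error
      MBSQI.HoldsWithProbGE κ (1 - δ) (fun θ =>
        MBSQI.tvDist (MBSQI.densityMeasure (lam.prod Measure.count) (muhat θ))
          (MBSQI.densityMeasure (lam.prod Measure.count) mu) ≤ epsMu) →
      -- completeness of `F` under the constrained Bellman optimality operator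
      (∀ᵐ θ ∂κ, ∀ f ∈ F, ∃ g ∈ F,
        MBSQI.l2norm (MBSQI.densityMeasure (lam.prod Measure.count) mu)
          (fun x => g x - M.bellman (muhat θ) b f x) ^ 2 ≤ epsF) →
      -- an optimal policy that is covered by `mu`
      M.IsOptimal πstar →
      M.etaDisc πstar {x | mu x ≤ 2 * b} ≤ ENNReal.ofReal ε →
      -- the dataset and the density estimate are independent
      MBSQI.HoldsWithProbGE
        (κ.prod (M.datasetLaw (MBSQI.densityMeasure (lam.prod Measure.count) mu) n)) (1 - 2 * δ)
        (fun ω : Θ × (Fin n → MBSQI.Sample S A) =>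
          ∀ (g : S → A) (hg : Measurable g),
            MBSQI.IsOutput M.γ F (muhat ω.1) b ω.2 t g →
            M.value (MBSQI.Policy.ofFun g hg) ≥ M.optValue -
              MBSQI.errorBound c M.γ Vmax U b δ epsF epsMu (ε + U / b * epsMu)
                (MBSQI.l2norm (MBSQI.densityMeasure (lam.prod Measure.count) mu)
                  (fun x => M.Q πstar x - M.bellman (muhat ω.1) b (M.Q πstar) x))
                F.card n t) := by
  refine ⟨32, by norm_num, ?_⟩
  intro S A Θ _ _ _ _ _ lam _ M V U b δ ε epsMu epsF mu F κ _ muhat n t πstar hn ht hb hδ hδ1 hε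
    hQ hR hF hmu hmuhat hdens hU htv hcomplete hopt hcover
  have := hmu.isProbabilityMeasure
  have hS : Nonempty S := nonempty_of_isProbabilityMeasure M.ρ
  have hA : Nonempty A := nonempty_of_isProbabilityMeasure (πstar.kernel hS.some)
  have hV : 0 ≤ V := (hQ πstar (hS.some, hA.some)).1.trans (hQ πstar (hS.some, hA.some)).2
  have hC : 0 ≤ U / b := div_nonneg (hU (fun _ => πstar) 0).nonneg hb.le
  have htop : M.optValue ≤ M.value πstar := MBSQI.optValue_le_of_isOptimal hopt
  have hδ2 : ENNReal.ofReal (1 - 2 * δ) ≤ (κ.prod (M.datasetLaw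
      (MBSQI.densityMeasure (lam.prod Measure.count) mu) n)) Set.univ := by
    rw [measure_univ, ← ENNReal.ofReal_one]
    exact ENNReal.ofReal_le_ofReal (by linarith)
  -- For `V = 0` the scale `a` of the regression error would vanish and the temperature degenerate;
  -- but then all values are zero.
  rcases hV.eq_or_lt with rfl | hVpos
  · refine ⟨Set.univ, MeasurableSet.univ, hδ2, fun ω _ g hg _ => ?_⟩
    have hzero : ∀ π, M.value π = 0 := fun π => by
      have hQ0 : ∀ x, M.Q π x = 0 := fun x => le_antisymm (hQ π x).2 (hQ π x).1
      simp [MBSQI.MDP.value, MBSQI.MDP.V, hQ0]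
    rw [hzero] at htop ⊢
    have := MBSQI.errorBound_nonneg_of_Vmax_eq_zero (c := 32) (γ := M.γ) (δ := δ) (epsF := epsF)
      (epsMu := epsMu) (epsZeta := ε + U / b * epsMu)
      (res := MBSQI.l2norm (MBSQI.densityMeasure (lam.prod Measure.count) mu)
        (fun x => M.Q πstar x - M.bellman (muhat ω.1) b (M.Q πstar) x)) (N := F.card) (n := n)
      (t := t) hC (Real.sqrt_nonneg _) (by norm_num)
    linarith
  rcases F.eq_empty_or_nonempty with rfl | hFne
  · refine ⟨Set.univ, MeasurableSet.univ, hδ2, fun ω _ g hg hout => ?_⟩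
    obtain ⟨f, h0, -⟩ := hout
    exact absurd h0 (Finset.notMem_empty _)
  have hN : (1 : ℝ) ≤ F.card := Nat.one_le_cast.2 hFne.card_pos
  have hnpos : (0 : ℝ) < n := Nat.cast_pos.2 hn
  have hl : 0 < Real.log (F.card / δ) := Real.log_pos ((one_lt_div hδ).2 (by linarith))
  have ha : 0 < Real.sqrt (V ^ 2 * Real.log (F.card / δ) / n) := Real.sqrt_pos.2 (by positivity)
  have hasq : Real.sqrt (V ^ 2 * Real.log (F.card / δ) / n) ^ 2 =
      V ^ 2 * Real.log (F.card / δ) / n := Real.sq_sqrt (by positivity)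
  -- The cube from the union bound costs only the factor `3` that the fast rate allows for; `δ < 1`
  -- is used here.
  have hL : Real.log (F.card ^ 3 / δ) ≤ 3 * Real.log (F.card / δ) := by
    rw [Real.log_div (by positivity) hδ.ne', Real.log_div (by positivity) hδ.ne', Real.log_pow]
    have := Real.log_neg hδ hδ1
    push_cast
    linarith
  obtain ⟨G, hG, hGp, hGE⟩ := MBSQI.exists_measurableSet_deviation_lt (b := b)
    (m := MBSQI.densityMeasure (lam.prod Measure.count) mu) hR hVpos hmuhat hFne hF ha hδ hδ1 n
    htv hcomplete
  refine ⟨G, hG, hGp, fun ω hω g hg hout => ?_⟩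
  obtain ⟨htvω, hcompω, hdev⟩ := hGE ω hω
  obtain ⟨f, hf0, hstep, hgreedy⟩ := hout
  obtain ⟨k, rfl⟩ : ∃ k, t = k + 1 := ⟨t - 1, by omega⟩
  have hfF : ∀ j ≤ k + 1, f j ∈ F := by
    intro j hj
    cases j with
    | zero => exact hf0
    | succ j => exact (hstep j hj).1
  have hd : ∀ j < k + 1, MBSQI.l2norm (MBSQI.densityMeasure (lam.prod Measure.count) mu)
      (fun x => f (j + 1) x - M.bellman (muhat ω.1) b (f j) x) ≤
      32 * Real.sqrt (V ^ 2 * Real.log (F.card / δ) / n) + Real.sqrt epsF := by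
    intro j hj
    -- Completeness supplies the comparator `v` for the regression with targets from `f j`.
    obtain ⟨v, hv, hveps⟩ := hcompω (f j) (hfF j hj.le)
    have h1 := MBSQI.regError_le_of_deviation_lt hn hVpos ha hasq hL
      (hdev (f j) (hfF j hj.le) (f (j + 1)) (hfF (j + 1) hj) v hv) ((hstep j hj).2 v hv)
    have h2 : MBSQI.regError M (MBSQI.densityMeasure (lam.prod Measure.count) mu) (muhat ω.1) b
        (f j) v ≤ Real.sqrt epsF := Real.le_sqrt_of_sq_le hveps
    exact h1.trans (by linarith)
  have hstar := MBSQI.eta_zero_real_le πstar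
    (measurableSet_le hmu.measurable measurable_const) hε hcover
  have key := MBSQI.value_le_value_ofFun_add hR hQ hU hmu (hdens ω.1) hb hV htvω πstar hstar
    (fun j hj => (hF _ (hfF j hj)).1) (fun j hj => (hF _ (hfF j hj)).2) hd hg hgreedy
  unfold MBSQI.errorBound
  linarith
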